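/- A color graph consists of a finite node set $V$ and undirected edge sets $E_1,\dots,E_c$ on $V$, $c\ge 1$ (the edges of $E_i$ have color $i$; the number $c$ of colors is part of the input, and a pair of nodes may be joined by edges of several colors). Let $s\ne t$ be two nodes. A uni-color $st$-path of color $i$ is a simple path from $s$ to $t$ all of whose edges lie in $E_i$; its length is its number of edges. Two such paths are disjoint if they have no common internal node. For a fixed integer $l$, the problem $l$-LCDP asks, given a color graph and $s\neq t$, for a set of mutually disjoint uni-color $st$-paths of length at most $l$ (paths with different colors being different) with as many paths as possible. Theorem. For every fixed integer $l>3$ and every fixed real $\varepsilon>0$ there is a deterministic polynomial-time algorithm which, on every instance of $l$-LCDP, outputs a set $S$ of mutually disjoint uni-color $st$-paths of length at most $l$ such that $$\mathrm{OPT}\;\le\;\Bigl(\frac{l-1}{2}+\varepsilon\Bigr)\,|S| ,$$ where $\mathrm{OPT}$ is the maximum number of paths in such a set. Here polynomial time means that the number of steps of a random-access machine (unit cost; addition, truncated subtraction, tests for zero and indirect addressing) is bounded by a polynomial, depending only on $l$ and $\varepsilon$, in the size $4+c|V|^2$ of the input, which consists of $|V|$, $c$, $s$, $t$ and the $c$ adjacency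 matrices. -/

import Mathlib

/-! ### Random-access machines with a step count -/

namespace RAM

/-- The state of a random-access machine: registers (addressed directly by the program), a memory
(addressed indirectly, through registers), and the output written so far. -/
structure State where
  reg : ℕ → ℕ
  mem : ℕ → ℕ
  out : List ℕ

/-- Programs of a random-access machine with a read-only input array. The only arithmetic
operations are addition and (truncated) subtraction, so that unit cost per operation is
polynomially related to the running time of a Turing machine. -/
inductive Program where
  /-- do nothing -/
  | skip
  /-- register `r` := the constant `k` -/
  | const (r k : ℕ)
  /-- register `r` := register `a` + register `b` -/
  | add (r a b : ℕ)
  /-- register `r` := max(register `a` - register `b`, 0) -/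
  | sub (r a b : ℕ)
  /-- register `r` := the input entry whose index is in register `a` (0 beyond the end) -/
  | read (r a : ℕ)
  /-- register `r` := the memory cell whose address is in register `a` -/
  | load (r a : ℕ)
  /-- the memory cell whose address is in register `a` := register `b` -/
  | store (a b : ℕ)
  /-- append the value of register `a` to the output -/
  | write (a : ℕ)
  /-- run `P`, then `Q` -/
  | seq (P Q : Program)
  /-- run `P` if register `a` is nonzero, and `Q` otherwise -/
  | ifNonzero (a : ℕ) (P Q : Program)
  /-- run `P` as long as register `a` is nonzero -/
  | whileNonzero (a : ℕ) (P : Program)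

/-- `Exec x P σ t τ`: on the input array `x`, the program `P` started in state `σ` terminates in
state `τ` after exactly `t` steps. Every elementary operation and every test is one step. -/
inductive Exec (x : List ℕ) : Program → State → ℕ → State → Prop where
  | skip (σ : State) : Exec x .skip σ 1 σ
  | const (r k : ℕ) (σ : State) :
      Exec x (.const r k) σ 1 { σ with reg := Function.update σ.reg r k }
  | add (r a b : ℕ) (σ : State) :
      Exec x (.add r a b) σ 1 { σ with reg := Function.update σ.reg r (σ.reg a + σ.reg b) }
  | sub (r a b : ℕ) (σ : State) :
      Exec x (.sub r a b) σ 1 { σ with reg := Function.update σ.reg r (σ.reg a - σ.reg b) }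
  | read (r a : ℕ) (σ : State) :
      Exec x (.read r a) σ 1 { σ with reg := Function.update σ.reg r (x.getD (σ.reg a) 0) }
  | load (r a : ℕ) (σ : State) :
      Exec x (.load r a) σ 1 { σ with reg := Function.update σ.reg r (σ.mem (σ.reg a)) }
  | store (a b : ℕ) (σ : State) :
      Exec x (.store a b) σ 1 { σ with mem := Function.update σ.mem (σ.reg a) (σ.reg b) }
  | write (a : ℕ) (σ : State) :
      Exec x (.write a) σ 1 { σ with out := σ.out ++ [σ.reg a] }
  | seq {P Q : Program} {σ τ υ : State} {t u : ℕ} (hP : Exec x P σ t τ) (hQ : Exec x Q τ u υ) :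
      Exec x (.seq P Q) σ (t + u) υ
  | ifTrue {a : ℕ} {P Q : Program} {σ τ : State} {t : ℕ} (ha : σ.reg a ≠ 0)
      (hP : Exec x P σ t τ) : Exec x (.ifNonzero a P Q) σ (t + 1) τ
  | ifFalse {a : ℕ} {P Q : Program} {σ τ : State} {t : ℕ} (ha : σ.reg a = 0)
      (hQ : Exec x Q σ t τ) : Exec x (.ifNonzero a P Q) σ (t + 1) τ
  | whileTrue {a : ℕ} {P : Program} {σ τ υ : State} {t u : ℕ} (ha : σ.reg a ≠ 0)
      (hP : Exec x P σ t τ) (hW : Exec x (.whileNonzero a P) τ u υ) :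
      Exec x (.whileNonzero a P) σ (t + u + 1) υ
  | whileFalse {a : ℕ} {P : Program} {σ : State} (ha : σ.reg a = 0) :
      Exec x (.whileNonzero a P) σ 1 σ

/-- The machine is deterministic: the running time and the final state are unique. -/
theorem Exec.deterministic {x : List ℕ} {P : Program} {σ τ τ' : State} {t t' : ℕ}
    (h : Exec x P σ t τ) (h' : Exec x P σ t' τ') : t = t' ∧ τ = τ' := by
  induction h generalizing t' τ' with
  | seq _ _ ihP ihQ =>
    cases h' with
    | seq hP hQ =>
      obtain ⟨rfl, rfl⟩ := ihP hP
      obtain ⟨rfl, rfl⟩ := ihQ hQ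
      exact ⟨rfl, rfl⟩
  | ifTrue ha _ ih =>
    cases h' with
    | ifTrue _ hP => obtain ⟨rfl, rfl⟩ := ih hP; exact ⟨rfl, rfl⟩
    | ifFalse ha' _ => exact absurd ha' ha
  | ifFalse ha _ ih =>
    cases h' with
    | ifTrue ha' _ => exact absurd ha ha'
    | ifFalse _ hP => obtain ⟨rfl, rfl⟩ := ih hP; exact ⟨rfl, rfl⟩
  | whileTrue ha _ _ ihP ihW =>
    cases h' with
    | whileTrue _ hP hW =>
      obtain ⟨rfl, rfl⟩ := ihP hP
      obtain ⟨rfl, rfl⟩ := ihW hW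
      exact ⟨rfl, rfl⟩
    | whileFalse ha' => exact absurd ha' ha
  | whileFalse ha =>
    cases h' with
    | whileTrue ha' _ _ => exact absurd ha ha'
    | whileFalse _ => exact ⟨rfl, rfl⟩
  | _ => cases h'; exact ⟨rfl, rfl⟩

/-- The initial state: all registers and memory cells are zero, the output is empty. -/
def State.init : State where
  reg := fun _ => 0
  mem := fun _ => 0
  out := []

/-- On input `x`, the program `P` halts after exactly `t` steps, with output `y`. -/
def Program.Outputs (P : Program) (x : List ℕ) (t : ℕ) (y : List ℕ) : Prop :=
  ∃ τ : State, Exec x P State.init t τ ∧ τ.out = y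

end RAM

/-! ### Disjoint uni-color paths in color graphs -/

/-- An instance of the disjoint paths problem: a color graph, that is, a node set
`{0, …, n - 1}` with edge sets of colors `0, …, c - 1` (undirected; a pair of nodes may be joined
in several colors), and two nodes `s ≠ t`. The number `c` of colors is part of the instance. -/
structure CDPInstance where
  n : ℕ
  c : ℕ
  c_pos : 0 < c
  graph : Fin c → SimpleGraph (Fin n)
  s : Fin n
  t : Fin n
  s_ne_t : s ≠ t

namespace CDPInstance

/-- The input array of an instance: `n, c, s, t`, followed by the adjacency matrices of the colors
`0, …, c - 1`, row by row. It has `4 + c * n ^ 2` entries, none of them larger than that. -/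
noncomputable def encode (I : CDPInstance) : List ℕ :=
  open scoped Classical in
  [I.n, I.c, (I.s : ℕ), (I.t : ℕ)] ++
    (List.finRange I.c).flatMap fun i =>
      (List.finRange I.n).flatMap fun u =>
        (List.finRange I.n).map fun v => if (I.graph i).Adj u v then 1 else 0

/-- A uni-color path from `s` to `t`: a color and a path all of whose edges have that color. -/
structure UnicolorPath (I : CDPInstance) where
  color : Fin I.c
  walk : (I.graph color).Walk I.s I.t
  isPath : walk.IsPath

/-- Two paths from `s` to `t` are (internally) disjoint if they have no common internal node. -/
def UnicolorPath.InternallyDisjoint {I : CDPInstance} (P Q : I.UnicolorPath) : Prop :=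
  ∀ v, v ∈ P.walk.support → v ∈ Q.walk.support → v = I.s ∨ v = I.t

/-- A feasible solution of `l`-LCDP: a set (a list without repetition) of mutually disjoint
uni-color paths from `s` to `t`, each with at most `l` edges. -/
def IsFeasible (I : CDPInstance) (l : ℕ) (S : List I.UnicolorPath) : Prop :=
  S.Nodup ∧ (∀ P ∈ S, P.walk.length ≤ l) ∧ S.Pairwise UnicolorPath.InternallyDisjoint

/-- `S` is a feasible solution of `l`-LCDP, and the maximum number of paths in a feasible solution
is at most `α` times the number of paths in `S`. -/
def IsApproxSolution (I : CDPInstance) (l : ℕ) (α : ℝ) (S : List I.UnicolorPath) : Prop :=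
  I.IsFeasible l S ∧
    ∀ T : List I.UnicolorPath, I.IsFeasible l T → (T.length : ℝ) ≤ α * (S.length : ℝ)

/-- The output format: for each path its color, the number of its nodes, and its nodes in order. -/
def encodeSolution {I : CDPInstance} (S : List I.UnicolorPath) : List ℕ :=
  S.flatMap fun P =>
    (P.color : ℕ) :: P.walk.support.length :: P.walk.support.map fun v => (v : ℕ)

end CDPInstance

/-- The `l`-LCDP problem can be approximated with ratio `α` in polynomial time: one program finds,
on every instance, an `α`-approximate solution within a number of steps that is polynomial in the
size of the input. -/
def LCDPPolyTimeApproximable (l : ℕ) (α : ℝ) : Prop :=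
  ∃ (M : RAM.Program) (p : Polynomial ℕ), ∀ I : CDPInstance,
    ∃ (t : ℕ) (S : List I.UnicolorPath),
      M.Outputs I.encode t (CDPInstance.encodeSolution S) ∧
      t ≤ p.eval I.encode.length ∧
      I.IsApproxSolution l α S

/-! Put `k = l - 1`, the largest number of internal nodes of an admissible path. A path of length
one has no internal node and conflicts with nothing, so all of these are output. For the other paths
the task is to pack sets of at most `k` nodes, and the algorithm is local search in the manner of
Hurkens and Schrijver: as long as at most `P = (k + 1) ^ r` disjoint paths meet fewer current paths
than their own number, exchange them. Here `r` depends on `ε` only.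

Ratio: let `A` be the locally optimal set and `B` a competing one. A path of either set meets at
most `k` of the other, because the paths met are disjoint and use different internal nodes. Local
optimality is Hall's condition for subsets of `B` of size at most `P`.
`Finset.two_mul_card_le_of_local_hall` turns this into `2|B| ≤ (k + 1/r)|A|` by peeling off, `r`
times, the members of `B` with only one neighbour. With `r > 1/(2ε)` this is the claimed ratio.

Running time: the search is written in a small language in which every loop makes exactly `N = n +
c` rounds. Its semantics `Stmt.run` is a total function, so correctness is an ordinary induction,
and `Stmt.runs_compile` translates it to the machine with a step bound polynomial in `N`. The fixed
number `(k + 1) * P` of nested loops enumerates all candidates. The current paths are indexed by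
their first internal node, hence there are fewer than `N` of them, and `N` passes suffice because
every pass before local optimality gains a path (`exists_run_searchStmt`). -/

/-! ### Combinatorics of local optima -/

theorem Finset.two_mul_card_le_of_local_hall {α β : Type*} [DecidableEq α] [DecidableEq β]
    {k : ℕ} (hk : 2 ≤ k) (r : ℕ) (A : Finset α) (B : Finset β) (N : β → Finset α)
    (hNA : ∀ b ∈ B, N b ⊆ A) (hN : ∀ b ∈ B, (N b).card ≤ k)
    (hdeg : ∀ a ∈ A, (B.filter fun b => a ∈ N b).card ≤ k)
    (hall : ∀ S ⊆ B, S.card ≤ (k + 1) ^ r → S.card ≤ (S.biUnion N).card) :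
    r * (2 * B.card) ≤ r * (k * A.card) + A.card := by
  induction r generalizing A B N with
  | zero => simp
  | succ r ih =>
    have hpow : (k + 1) ≤ (k + 1) ^ (r + 1) := by
      rw [pow_succ]; exact Nat.le_mul_of_pos_left _ (by positivity)
    have hpos : ∀ b ∈ B, 1 ≤ (N b).card := fun b hb => by
      simpa using hall {b} (by simpa using hb) (by simp; omega)
    set B₁ := B.filter fun b => (N b).card = 1 with hB₁
    set A₁ := B₁.biUnion N with hA₁
    have hB₁B : B₁ ⊆ B := Finset.filter_subset _ _
    have hA₁A : A₁ ⊆ A := Finset.biUnion_subset.2 fun b hb => hNA b (hB₁B hb)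
    have hdisj : ∀ b ∈ B₁, ∀ b' ∈ B₁, ∀ a, a ∈ N b → a ∈ N b' → b = b' := by
      intro b hb b' hb' a ha ha'
      by_contra hne
      have h1 := (Finset.mem_filter.1 hb).2
      have h2 := (Finset.mem_filter.1 hb').2
      obtain ⟨y, hy⟩ := Finset.card_eq_one.1 h1
      obtain ⟨z, hz⟩ := Finset.card_eq_one.1 h2
      rw [hy, Finset.mem_singleton] at ha
      rw [hz, Finset.mem_singleton] at ha'
      have := hall {b, b'} (by
        intro u hu
        rcases Finset.mem_insert.1 hu with rfl | hu
        · exact hB₁B hb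
        · rw [Finset.mem_singleton.1 hu]; exact hB₁B hb')
        (by rw [Finset.card_pair hne]; omega)
      rw [Finset.card_pair hne] at this
      simp [hy, hz, ← ha, ← ha'] at this
    have hcard₁ : A₁.card = B₁.card := by
      rw [hA₁, Finset.card_biUnion, Finset.sum_congr rfl
        (fun b hb => (Finset.mem_filter.1 hb).2), Finset.sum_const, smul_eq_mul, mul_one]
      intro b hb b' hb' hne
      exact Finset.disjoint_left.2 fun a ha ha' => hne (hdisj b hb b' hb' a ha ha')
    -- double counting
    have hcount : ∑ b ∈ B, (N b).card ≤ k * A.card := by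
      have : ∑ b ∈ B, (N b).card = ∑ a ∈ A, (B.filter fun b => a ∈ N b).card := by
        refine Eq.trans ?_
          (Finset.sum_card_bipartiteAbove_eq_sum_card_bipartiteBelow (fun a b => a ∈ N b)).symm
        refine Finset.sum_congr rfl fun b hb => ?_
        congr 1
        ext a
        simp only [Finset.bipartiteBelow, Finset.mem_filter]
        exact ⟨fun h => ⟨hNA b hb h, h⟩, fun h => h.2⟩
      rw [this, mul_comm]
      exact (Finset.sum_le_card_nsmul _ _ _ hdeg).trans (by simp)
    -- Every member of `B` has at least two neighbours, except those of `B₁`, which have one; so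
    -- twice `|B|` exceeds the number of incidences by at most `|B₁| = |A₁|`.
    have hfirst : 2 * B.card ≤ k * A.card + A₁.card := by
      have h2 : ∑ b ∈ B, 2 ≤ ∑ b ∈ B, ((N b).card + if (N b).card = 1 then 1 else 0) := by
        refine Finset.sum_le_sum fun b hb => ?_
        have := hpos b hb
        split_ifs <;> omega
      rw [Finset.sum_add_distrib, ← Finset.card_filter, Finset.sum_const, smul_eq_mul, ← hB₁] at h2
      rw [hcard₁]
      omega
    -- the reduced system
    have hrec := ih (A \ A₁) (B \ B₁) (fun b => N b \ A₁)
      (fun b hb => Finset.sdiff_subset_sdiff (hNA b (Finset.mem_sdiff.1 hb).1) subset_rfl)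
      (fun b hb => (Finset.card_le_card Finset.sdiff_subset).trans
        (hN b (Finset.mem_sdiff.1 hb).1))
      (fun a ha => (Finset.card_le_card (by
        intro b hb
        simp only [Finset.mem_filter, Finset.mem_sdiff] at hb ⊢
        exact ⟨hb.1.1, hb.2.1⟩)).trans (hdeg a (Finset.mem_sdiff.1 ha).1))
      (by
        intro S hS hSc
        -- `X` is what `S` loses by the removal of `A₁`. Adding the members `Q` of `B₁` whose
        -- neighbours form `X` costs `|Q| = |X| ≤ k|S|`, so the enlarged set has at most `(k +
        -- 1)|S|` members. Hall's condition for it gives the one for `S` after cancelling `|X|`;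
        -- hence one factor `k + 1` per induction step.
        set X := S.biUnion N ∩ A₁ with hX
        set Q := B₁.filter fun b => ¬ Disjoint (N b) X with hQ
        have hQX : Q.biUnion N = X := by
          ext a
          simp only [Finset.mem_biUnion, hQ, Finset.mem_filter]
          constructor
          · rintro ⟨b, ⟨hb, hbX⟩, ha⟩
            obtain ⟨y, hy⟩ := Finset.card_eq_one.1 (Finset.mem_filter.1 hb).2
            obtain ⟨z, hz, hzX⟩ := Finset.not_disjoint_iff.1 hbX
            rw [hy, Finset.mem_singleton] at ha hz
            rw [ha, ← hz]; exact hzX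
          · intro ha
            obtain ⟨b, hb, hab⟩ := Finset.mem_biUnion.1 (Finset.mem_inter.1 ha).2
            exact ⟨b, ⟨hb, Finset.not_disjoint_iff.2 ⟨a, hab, ha⟩⟩, hab⟩
        have hQc : Q.card = X.card := by
          rw [← hQX, Finset.card_biUnion, Finset.sum_congr rfl
            (fun b hb => (Finset.mem_filter.1 (Finset.mem_filter.1 hb).1).2), Finset.sum_const,
            smul_eq_mul, mul_one]
          intro b hb b' hb' hne
          exact Finset.disjoint_left.2 fun a ha ha' => hne
            (hdisj b (Finset.mem_filter.1 hb).1 b' (Finset.mem_filter.1 hb').1 a ha ha')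
        have hSB : S ⊆ B := fun b hb => (Finset.mem_sdiff.1 (hS hb)).1
        have hSQ : Disjoint S Q := Finset.disjoint_left.2 fun b hb hb' =>
          (Finset.mem_sdiff.1 (hS hb)).2 (Finset.mem_filter.1 hb').1
        have hXc : X.card ≤ S.card * k := (Finset.card_le_card Finset.inter_subset_left).trans
          (Finset.card_biUnion_le_card_mul _ _ _ fun b hb => hN b (hSB hb))
        have hS' := hall (S ∪ Q) (Finset.union_subset hSB
          ((Finset.filter_subset _ _).trans hB₁B)) (by
            rw [Finset.card_union_of_disjoint hSQ, hQc, pow_succ]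
            calc S.card + X.card ≤ S.card * (k + 1) := by rw [mul_add]; omega
              _ ≤ _ := Nat.mul_le_mul_right _ hSc)
        rw [Finset.card_union_of_disjoint hSQ, Finset.union_biUnion, hQX, hQc] at hS'
        have hsub : S.biUnion N ∪ X ⊆ (S.biUnion fun b => N b \ A₁) ∪ X := by
          intro a ha
          rcases Finset.mem_union.1 ha with ha | ha
          · by_cases h : a ∈ A₁
            · exact Finset.mem_union_right _ (Finset.mem_inter.2 ⟨ha, h⟩)
            · obtain ⟨b, hb, hab⟩ := Finset.mem_biUnion.1 ha
              exact Finset.mem_union_left _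
                (Finset.mem_biUnion.2 ⟨b, hb, Finset.mem_sdiff.2 ⟨hab, h⟩⟩)
          · exact Finset.mem_union_right _ ha
        have := (Finset.card_le_card hsub).trans (Finset.card_union_le _ _)
        omega)
    have hA := Finset.card_sdiff_add_card_eq_card hA₁A
    have hB := Finset.card_sdiff_add_card_eq_card hB₁B
    rw [← hA, ← hB] at hfirst ⊢
    rw [← hcard₁] at hfirst ⊢
    generalize (A \ A₁).card = a at *
    generalize (B \ B₁).card = b at *
    generalize A₁.card = d at *
    -- The claim is the sum of `hfirst`, `hrec` and this inequality for the `d` removed pairs; the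
    -- error terms `d` and `a` add up to `|A|`.
    have h3 : r * (2 * d) ≤ r * (k * d) :=
      Nat.mul_le_mul_left _ (Nat.mul_le_mul_right _ hk)
    nlinarith

/-! ### A language of bounded loops and its compilation -/

namespace RAM

/-- Expressions over immutable variables, the input array and the memory. -/
inductive Expr where
  | const (k : ℕ)
  | var (r : ℕ)
  | add (a b : Expr)
  | sub (a b : Expr)
  | read (a : Expr)
  | load (a : Expr)
  | ite (a b c : Expr)
  /-- the sum of `a` over all values of the variable `r` below the loop bound -/
  | sum (r : ℕ) (a : Expr)

/-- The value of an expression on the input `x`, with loop bound `N`, values `ρ` of the variables,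
and memory `m`. -/
def Expr.eval (x : List ℕ) (N : ℕ) (m : ℕ → ℕ) : Expr → (ℕ → ℕ) → ℕ
  | const k, _ => k
  | var r, ρ => ρ r
  | add a b, ρ => a.eval x N m ρ + b.eval x N m ρ
  | sub a b, ρ => a.eval x N m ρ - b.eval x N m ρ
  | read a, ρ => x.getD (a.eval x N m ρ) 0
  | load a, ρ => m (a.eval x N m ρ)
  | ite a b c, ρ => if a.eval x N m ρ ≠ 0 then b.eval x N m ρ else c.eval x N m ρ
  | sum r a, ρ => ∑ i ∈ Finset.range N, a.eval x N m (Function.update ρ r i)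

/-- Statements: all loops run over the values of a variable below one common loop bound. -/
inductive Stmt where
  | skip
  | store (a b : Expr)
  | write (a : Expr)
  | seq (P Q : Stmt)
  | ite (a : Expr) (P Q : Stmt)
  | loop (r : ℕ) (P : Stmt)

/-- `iterate f n y` is `f (n - 1) (… (f 0 y))`. -/
def iterate {α : Type*} (f : ℕ → α → α) : ℕ → α → α
  | 0, y => y
  | n + 1, y => f n (iterate f n y)

/-- The effect of a statement on the memory and the output. -/
def Stmt.run (x : List ℕ) (N : ℕ) : Stmt → (ℕ → ℕ) → (ℕ → ℕ) × List ℕ → (ℕ → ℕ) × List ℕ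
  | skip, _, y => y
  | store a b, ρ, y => (Function.update y.1 (a.eval x N y.1 ρ) (b.eval x N y.1 ρ), y.2)
  | write a, ρ, y => (y.1, y.2 ++ [a.eval x N y.1 ρ])
  | seq P Q, ρ, y => Q.run x N ρ (P.run x N ρ y)
  | ite a P Q, ρ, y => if a.eval x N y.1 ρ ≠ 0 then P.run x N ρ y else Q.run x N ρ y
  | loop r P, ρ, y => iterate (fun i z => P.run x N (Function.update ρ r i) z) N y

/-- The registers of the machine represent the variables `ρ` (even registers) and `d` scratch
cells `g` (odd registers). -/
structure Represents (ρ g : ℕ → ℕ) (d : ℕ) (y : (ℕ → ℕ) × List ℕ) (σ : State) : Prop where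
  var : ∀ r, σ.reg (2 * r) = ρ r
  scratch : ∀ j < d, σ.reg (2 * j + 1) = g j
  mem : σ.mem = y.1
  out : σ.out = y.2

namespace Represents

variable {ρ g : ℕ → ℕ} {d : ℕ} {y : (ℕ → ℕ) × List ℕ} {σ : State}

theorem mono {d' : ℕ} (h : Represents ρ g d y σ) (hd : d' ≤ d) : Represents ρ g d' y σ :=
  ⟨h.var, fun j hj => h.scratch j (by omega), h.mem, h.out⟩

theorem congr {g' : ℕ → ℕ} (h : Represents ρ g d y σ) (hg : ∀ j < d, g j = g' j) :
    Represents ρ g' d y σ :=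
  ⟨h.var, fun j hj => (h.scratch j hj).trans (hg j hj), h.mem, h.out⟩

theorem push (h : Represents ρ g d y σ) (v : ℕ) :
    Represents ρ (Function.update g d v) (d + 1) y
      { σ with reg := Function.update σ.reg (2 * d + 1) v } := by
  refine ⟨fun r => ?_, fun j hj => ?_, h.mem, h.out⟩
  · simp only
    rw [Function.update_of_ne (by omega), h.var]
  · rcases eq_or_ne j d with rfl | hne
    · simp
    · simp only
      rw [Function.update_of_ne (by omega), Function.update_of_ne hne, h.scratch j (by omega)]

theorem set {j : ℕ} (h : Represents ρ g d y σ) (v : ℕ) :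
    Represents ρ (Function.update g j v) d y
      { σ with reg := Function.update σ.reg (2 * j + 1) v } := by
  refine ⟨fun r => ?_, fun i hi => ?_, h.mem, h.out⟩
  · simp only
    rw [Function.update_of_ne (by omega), h.var]
  · rcases eq_or_ne i j with rfl | hne
    · simp
    · simp only
      rw [Function.update_of_ne (by omega), Function.update_of_ne hne, h.scratch i hi]

theorem setVar (h : Represents ρ g d y σ) (r v : ℕ) :
    Represents (Function.update ρ r v) g d y
      { σ with reg := Function.update σ.reg (2 * r) v } := by
  refine ⟨fun i => ?_, fun j hj => ?_, h.mem, h.out⟩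
  · rcases eq_or_ne i r with rfl | hne
    · simp
    · simp only
      rw [Function.update_of_ne (by omega), Function.update_of_ne hne, h.var]
  · simp only
    rw [Function.update_of_ne (by omega), h.scratch j hj]

end Represents

/-- `P` transforms states with property `p` into states with property `q` in at most `T` steps. -/
def Runs (x : List ℕ) (P : Program) (T : ℕ) (p q : State → Prop) : Prop :=
  ∀ σ, p σ → ∃ t ≤ T, ∃ τ, Exec x P σ t τ ∧ q τ

theorem Runs.seq {x : List ℕ} {P Q : Program} {T U : ℕ} {p q s : State → Prop}
    (hP : Runs x P T p q) (hQ : Runs x Q U q s) : Runs x (.seq P Q) (T + U) p s := by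
  intro σ hσ
  obtain ⟨t, ht, τ, h1, hτ⟩ := hP σ hσ
  obtain ⟨u, hu, υ, h2, hυ⟩ := hQ τ hτ
  exact ⟨t + u, by omega, υ, .seq h1 h2, hυ⟩

/-- The invariant forces the tested register to count down from `N`, so induction on the number of
rounds left gives both termination and the bound. -/
theorem Runs.while {x : List ℕ} {a : ℕ} {P : Program} {T : ℕ} (I : ℕ → State → Prop)
    (N : ℕ) (hI : ∀ i ≤ N, ∀ σ, I i σ → σ.reg a = N - i)
    (hP : ∀ i < N, Runs x P T (I i) (I (i + 1))) :
    Runs x (.whileNonzero a P) (N * (T + 1) + 1) (I 0) (I N) := by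
  suffices ∀ j ≤ N, Runs x (.whileNonzero a P) (j * (T + 1) + 1) (I (N - j)) (I N) by
    simpa using this N le_rfl
  intro j
  induction j with
  | zero => exact fun _ σ hσ => ⟨1, by omega, σ, .whileFalse (by simpa using hI N le_rfl σ hσ), hσ⟩
  | succ j ih =>
    intro hj σ hσ
    obtain ⟨t, ht, τ, h1, hτ⟩ := hP (N - (j + 1)) (by omega) σ hσ
    rw [show N - (j + 1) + 1 = N - j by omega] at hτ
    obtain ⟨u, hu, υ, h2, hυ⟩ := ih (by omega) τ hτ
    refine ⟨t + u + 1, ?_, υ, .whileTrue ?_ h1 h2, hυ⟩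
    · rw [add_mul]; omega
    · rw [hI _ (by omega) σ hσ]; omega

theorem Runs.mono {x : List ℕ} {P : Program} {T T' : ℕ} {p p' q q' : State → Prop}
    (h : Runs x P T p q) (hT : T ≤ T') (hp : ∀ σ, p' σ → p σ) (hq : ∀ σ, q σ → q' σ) :
    Runs x P T' p' q' := by
  intro σ hσ
  obtain ⟨t, ht, τ, h1, hτ⟩ := h σ (hp σ hσ)
  exact ⟨t, ht.trans hT, τ, h1, hq τ hτ⟩

theorem runs_const {x : List ℕ} {p q : State → Prop} {r k : ℕ}
    (hq : ∀ σ, p σ → q { σ with reg := Function.update σ.reg r k }) :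
    Runs x (.const r k) 1 p q :=
  fun σ hσ => ⟨1, le_rfl, _, .const _ _ _, hq σ hσ⟩

theorem runs_add {x : List ℕ} {p q : State → Prop} {r a b : ℕ} (u v : ℕ)
    (ha : ∀ σ, p σ → σ.reg a = u) (hb : ∀ σ, p σ → σ.reg b = v)
    (hq : ∀ σ, p σ → q { σ with reg := Function.update σ.reg r (u + v) }) :
    Runs x (.add r a b) 1 p q := by
  refine fun σ hσ => ⟨1, le_rfl, _, .add _ _ _ _, ?_⟩
  rw [ha σ hσ, hb σ hσ]
  exact hq σ hσ

theorem runs_sub {x : List ℕ} {p q : State → Prop} {r a b : ℕ} (u v : ℕ)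
    (ha : ∀ σ, p σ → σ.reg a = u) (hb : ∀ σ, p σ → σ.reg b = v)
    (hq : ∀ σ, p σ → q { σ with reg := Function.update σ.reg r (u - v) }) :
    Runs x (.sub r a b) 1 p q := by
  refine fun σ hσ => ⟨1, le_rfl, _, .sub _ _ _ _, ?_⟩
  rw [ha σ hσ, hb σ hσ]
  exact hq σ hσ

theorem runs_read {x : List ℕ} {p q : State → Prop} {r a : ℕ} (u : ℕ)
    (ha : ∀ σ, p σ → σ.reg a = u)
    (hq : ∀ σ, p σ → q { σ with reg := Function.update σ.reg r (x.getD u 0) }) :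
    Runs x (.read r a) 1 p q := by
  refine fun σ hσ => ⟨1, le_rfl, _, .read _ _ _, ?_⟩
  rw [ha σ hσ]
  exact hq σ hσ

theorem runs_ifNonzero {x : List ℕ} {p q : State → Prop} {a T U : ℕ} {P Q : Program} (u : ℕ)
    (ha : ∀ σ, p σ → σ.reg a = u) (hP : u ≠ 0 → Runs x P T p q) (hQ : u = 0 → Runs x Q U p q) :
    Runs x (.ifNonzero a P Q) (T + U + 1) p q := by
  intro σ hσ
  by_cases h : u = 0
  · obtain ⟨t, ht, τ, h1, h2⟩ := hQ h σ hσ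
    exact ⟨t + 1, by omega, τ, .ifFalse (by rw [ha σ hσ, h]) h1, h2⟩
  · obtain ⟨t, ht, τ, h1, h2⟩ := hP h σ hσ
    exact ⟨t + 1, by omega, τ, .ifTrue (by rwa [ha σ hσ]) h1, h2⟩

/-- Runs `P` for all values of variable `r` below the loop bound; scratch cell `d` saves the
variable and scratch cell `d + 1` counts the remaining rounds. -/
def forProgram (r d : ℕ) (P : Program) : Program :=
  .seq (.const (2 * d + 1) 0) <| .seq (.add (2 * d + 1) (2 * r) (2 * d + 1)) <|
  .seq (.const (2 * r) 0) <| .seq (.add (2 * (d + 1) + 1) (2 * 0 + 1) (2 * r)) <|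
  .seq (.whileNonzero (2 * (d + 1) + 1) (.seq P <| .seq (.const (2 * (d + 2) + 1) 1) <|
    .seq (.add (2 * r) (2 * r) (2 * (d + 2) + 1))
      (.sub (2 * (d + 1) + 1) (2 * (d + 1) + 1) (2 * (d + 2) + 1)))) <|
  .add (2 * r) (2 * d + 1) (2 * (d + 1) + 1)

/-- `g i` and `y i` describe the scratch cells below `d` and the memory with output after `i`
rounds. The cells are allowed to vary since a sum accumulates in one of them; the body must only
preserve the two bookkeeping cells `d` and `d + 1`. -/
theorem runs_forProgram {x : List ℕ} {r d N T : ℕ} {P : Program} {ρ : ℕ → ℕ} (hd : 0 < d)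
    (g : ℕ → ℕ → ℕ) (y : ℕ → (ℕ → ℕ) × List ℕ) (hg : g 0 0 = N)
    (hP : ∀ i < N, ∀ g', (∀ j < d, g' j = g i j) → Runs x P T
      (Represents (Function.update ρ r i) g' (d + 2) (y i))
      (fun τ => ∃ g'', (∀ j < d, g'' j = g (i + 1) j) ∧ g'' d = g' d ∧ g'' (d + 1) = g' (d + 1) ∧
        Represents (Function.update ρ r i) g'' (d + 2) (y (i + 1)) τ)) :
    Runs x (forProgram r d P) (N * (T + 4) + 6)
      (Represents ρ (g 0) d (y 0)) (Represents ρ (g N) d (y N)) := by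
  let I : ℕ → State → Prop := fun i σ => ∃ g', (∀ j < d, g' j = g i j) ∧ g' d = ρ r ∧
    g' (d + 1) = N - i ∧ Represents (Function.update ρ r i) g' (d + 2) (y i) σ
  have hloop : Runs x (.whileNonzero (2 * (d + 1) + 1) (.seq P <|
      .seq (.const (2 * (d + 2) + 1) 1) <| .seq (.add (2 * r) (2 * r) (2 * (d + 2) + 1))
      (.sub (2 * (d + 1) + 1) (2 * (d + 1) + 1) (2 * (d + 2) + 1))))
      (N * (T + 3 + 1) + 1) (I 0) (I N) := by
    refine Runs.while I N ?_ ?_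
    · rintro i hi σ ⟨g', h1, h2, h3, h4⟩
      rw [h4.scratch (d + 1) (by omega), h3]
    · rintro i hi σ ⟨g', h1, h2, h3, h4⟩
      obtain ⟨t, ht, τ, hE, g'', k1, k2, k3, k4⟩ := hP i hi g' h1 σ h4
      have hrest : Runs x (.seq (.const (2 * (d + 2) + 1) 1) <|
          .seq (.add (2 * r) (2 * r) (2 * (d + 2) + 1))
          (.sub (2 * (d + 1) + 1) (2 * (d + 1) + 1) (2 * (d + 2) + 1))) (1 + (1 + 1))
          (Represents (Function.update ρ r i) g'' (d + 2) (y (i + 1)))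
          (Represents (Function.update ρ r (i + 1))
            (Function.update (Function.update g'' (d + 2) 1) (d + 1) (N - (i + 1))) (d + 3)
            (y (i + 1))) := by
        refine (runs_const fun σ h => h.push 1).seq
          ((runs_add i 1 (fun σ h => ?_) (fun σ h => ?_) fun σ h => h.setVar r _).seq
            (runs_sub (N - i) 1 (fun σ h => ?_) (fun σ h => ?_) fun σ h => ?_))
        · rw [h.var, Function.update_self]
        · rw [h.scratch _ (by omega), Function.update_self]
        · rw [h.scratch _ (by omega), Function.update_of_ne (by omega), k3, h3]
        · rw [h.scratch _ (by omega), Function.update_self]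
        · rw [Function.update_idem] at h
          rw [← Nat.sub_sub]
          exact h.set _
      obtain ⟨u, hu, υ, hE', hυ⟩ := hrest τ k4
      refine ⟨t + u, by omega, _, .seq hE hE', _, ?_, ?_, ?_, hυ.mono (by omega)⟩
      · intro j hj
        rw [Function.update_of_ne (by omega), Function.update_of_ne (by omega), k1 j hj]
      · rw [Function.update_of_ne (by omega), Function.update_of_ne (by omega), k2, h2]
      · rw [Function.update_self]
  refine Runs.mono (T := 1 + (1 + (1 + (1 + (N * (T + 3 + 1) + 1 + 1)))))
    (.seq (runs_const fun σ h => h.push 0) <|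
    .seq (runs_add (ρ r) 0 (fun σ h => ?_) (fun σ h => ?_) fun σ h => h.set (ρ r)) <|
    .seq (runs_const fun σ h => h.setVar r 0) <|
    -- Registers are copied by adding a zero: here the freshly reset loop variable, at the end the
    -- exhausted counter.
    .seq (q := I 0) (runs_add N 0 (fun σ h => ?_) (fun σ h => ?_) fun σ h => ?_) <|
    .seq hloop <| runs_add (ρ r) 0 ?_ ?_ ?_) (by ring_nf; omega) (fun σ h => h) fun σ h => h
  · exact h.var r
  · rw [h.scratch _ (by omega), Function.update_self]
  · rw [h.scratch _ (by omega), Function.update_of_ne (by omega), Function.update_of_ne (by omega),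
      hg]
  · rw [h.var, Function.update_self]
  · refine ⟨_, ?_, ?_, ?_, h.push _⟩
    · intro j hj
      rw [Function.update_of_ne (by omega), Function.update_of_ne (by omega),
        Function.update_of_ne (by omega)]
    · rw [Function.update_of_ne (by omega), Function.update_self]
    · rw [Function.update_self]; rfl
  · rintro σ ⟨g', -, h2, -, h4⟩
    rw [h4.scratch _ (by omega), h2]
  · rintro σ ⟨g', -, -, h3, h4⟩
    rw [h4.scratch _ (by omega), h3, Nat.sub_self]
  · rintro σ ⟨g', h1, -, -, h4⟩
    have := ((h4.setVar r (ρ r)).mono (show d ≤ d + 2 by omega)).congr h1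
    rwa [Function.update_idem, Function.update_eq_self] at this

/-- The program that puts the value of an expression into scratch cell `d`. -/
def Expr.compile : Expr → ℕ → Program
  | const k, d => .const (2 * d + 1) k
  | var r, d => .seq (.const (2 * d + 1) 0) (.add (2 * d + 1) (2 * r) (2 * d + 1))
  | add a b, d => .seq (a.compile d) <| .seq (b.compile (d + 1)) <|
      .add (2 * d + 1) (2 * d + 1) (2 * (d + 1) + 1)
  | sub a b, d => .seq (a.compile d) <| .seq (b.compile (d + 1)) <|
      .sub (2 * d + 1) (2 * d + 1) (2 * (d + 1) + 1)
  | read a, d => .seq (a.compile d) (.read (2 * d + 1) (2 * d + 1))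
  | load a, d => .seq (a.compile d) (.load (2 * d + 1) (2 * d + 1))
  | ite a b c, d => .seq (a.compile d) <| .ifNonzero (2 * d + 1) (b.compile d) (c.compile d)
  | sum r a, d => .seq (.const (2 * d + 1) 0) <| forProgram r (d + 1) <|
      .seq (a.compile (d + 3)) <| .add (2 * d + 1) (2 * d + 1) (2 * (d + 3) + 1)

/-- A bound for the running time of a compiled expression as a function of the loop bound. -/
noncomputable def Expr.time : Expr → Polynomial ℕ
  | const _ => 1
  | var _ => 2
  | add a b => a.time + (b.time + 1)
  | sub a b => a.time + (b.time + 1)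
  | read a => a.time + 1
  | load a => a.time + 1
  | ite a b c => a.time + (b.time + c.time + 1)
  | sum _ a => 1 + (Polynomial.X * (a.time + 1 + 4) + 6)

/-- Scratch cells form a stack: code compiled at depth `d` leaves the cells below `d` intact and may
overwrite those above. Cell `0` permanently holds the loop bound, hence `0 < d`. -/
theorem Expr.runs_compile {x : List ℕ} {N : ℕ} (y : (ℕ → ℕ) × List ℕ) (e : Expr)
    (ρ g : ℕ → ℕ) (d : ℕ) (hd : 0 < d) (hg : g 0 = N) :
    Runs x (e.compile d) (e.time.eval N) (Represents ρ g d y)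
      (Represents ρ (Function.update g d (e.eval x N y.1 ρ)) (d + 1) y) := by
  have hup : ∀ (g : ℕ → ℕ) d, 0 < d → g 0 = N → ∀ v, Function.update g d v 0 = N :=
    fun g d hd hg v => by rw [Function.update_of_ne (by omega), hg]
  induction e generalizing ρ g d with
  | const k =>
    simp only [time, Polynomial.eval_one]
    exact runs_const fun σ h => h.push k
  | var r =>
    refine ((runs_const fun σ h => h.push 0).seq
      (runs_add (ρ r) 0 (fun σ h => h.var r) (fun σ h => ?_) fun σ h => ?_)).mono
      (by simp [time]) (fun _ h => h) fun _ h => h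
    · rw [h.scratch _ (by omega), Function.update_self]
    · simpa [eval] using h.set (j := d) (ρ r)
  | add a b iha ihb =>
    simp only [time, Polynomial.eval_add, Polynomial.eval_one]
    refine (iha ρ g d hd hg).seq ((ihb ρ _ (d + 1) (by omega) (hup g d hd hg _)).seq
      (runs_add (a.eval x N y.1 ρ) (b.eval x N y.1 ρ) (fun σ h => ?_) (fun σ h => ?_)
        fun σ h => ?_))
    · rw [h.scratch _ (by omega), Function.update_of_ne (by omega), Function.update_self]
    · rw [h.scratch _ (by omega), Function.update_self]
    · refine ((h.set (j := d) _).mono (by omega)).congr fun j hj => ?_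
      rcases eq_or_ne j d with rfl | hne
      · simp [eval]
      · simp only [Function.update_of_ne hne]
        rw [Function.update_of_ne (by omega), Function.update_of_ne hne]
  | sub a b iha ihb =>
    simp only [time, Polynomial.eval_add, Polynomial.eval_one]
    refine (iha ρ g d hd hg).seq ((ihb ρ _ (d + 1) (by omega) (hup g d hd hg _)).seq
      (runs_sub (a.eval x N y.1 ρ) (b.eval x N y.1 ρ) (fun σ h => ?_) (fun σ h => ?_)
        fun σ h => ?_))
    · rw [h.scratch _ (by omega), Function.update_of_ne (by omega), Function.update_self]
    · rw [h.scratch _ (by omega), Function.update_self]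
    · refine ((h.set (j := d) _).mono (by omega)).congr fun j hj => ?_
      rcases eq_or_ne j d with rfl | hne
      · simp [eval]
      · simp only [Function.update_of_ne hne]
        rw [Function.update_of_ne (by omega), Function.update_of_ne hne]
  | read a ih =>
    simp only [time, Polynomial.eval_add, Polynomial.eval_one]
    refine (ih ρ g d hd hg).seq (runs_read (a.eval x N y.1 ρ) (fun σ h => ?_) fun σ h => ?_)
    · rw [h.scratch _ (by omega), Function.update_self]
    · simpa [eval] using h.set (j := d) (x.getD (a.eval x N y.1 ρ) 0)
  | load a ih =>
    simp only [time, Polynomial.eval_add, Polynomial.eval_one]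
    refine (ih ρ g d hd hg).seq fun σ h => ⟨1, le_rfl, _, .load _ _ _, ?_⟩
    have := h.set (j := d) (y.1 (a.eval x N y.1 ρ))
    have e : σ.mem (σ.reg (2 * d + 1)) = y.1 (a.eval x N y.1 ρ) := by
      rw [h.scratch _ (by omega), Function.update_self, h.mem]
    rw [e]
    simpa [eval] using this
  | ite a b c iha ihb ihc =>
    simp only [time, Polynomial.eval_add, Polynomial.eval_one]
    refine (iha ρ g d hd hg).seq (runs_ifNonzero (a.eval x N y.1 ρ) (fun σ h => ?_) ?_ ?_)
    · rw [h.scratch _ (by omega), Function.update_self]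
    · intro h
      refine (ihb ρ g d hd hg).mono le_rfl (fun σ h => (h.mono (by omega)).congr fun j hj => ?_)
        fun σ h' => ?_
      · rw [Function.update_of_ne (by omega)]
      · simpa [eval, h] using h'
    · intro h
      refine (ihc ρ g d hd hg).mono le_rfl (fun σ h => (h.mono (by omega)).congr fun j hj => ?_)
        fun σ h' => ?_
      · rw [Function.update_of_ne (by omega)]
      · simpa [eval, h] using h'
  | sum r a ih =>
    simp only [time, Polynomial.eval_add, Polynomial.eval_one, Polynomial.eval_mul,
      Polynomial.eval_X, Polynomial.eval_ofNat]
    -- The partial sum sits in cell `d`, just below the frame of the loop, so it belongs to the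
    -- varying part of `g`.
    refine (runs_const fun σ h => h.push 0).seq (runs_forProgram (d := d + 1) (by omega)
      (fun n => Function.update g d
        (∑ i ∈ Finset.range n, a.eval x N y.1 (Function.update ρ r i))) (fun _ => y)
      (hup g d hd hg _) ?_)
    intro i hi g' hg'
    have hg0 : g' 0 = N := by rw [hg' 0 (by omega), hup g d hd hg]
    refine ((ih (Function.update ρ r i) g' (d + 3) (by omega) hg0).seq
      (runs_add (g' d) (a.eval x N y.1 (Function.update ρ r i)) ?_ ?_ fun σ h =>
        h.set (j := d) _)).mono le_rfl (fun σ h => h) ?_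
    · intro σ h
      rw [h.scratch _ (by omega), Function.update_of_ne (by omega)]
    · intro σ h
      rw [h.scratch _ (by omega), Function.update_self]
    · refine fun σ h => ⟨_, fun j hj => ?_, ?_, ?_, h.mono (by omega)⟩
      · rcases eq_or_ne j d with rfl | hne
        · rw [Function.update_self, Function.update_self, Finset.sum_range_succ, hg' _ hj,
            Function.update_self]
        · rw [Function.update_of_ne hne, Function.update_of_ne (by omega), hg' j hj,
            Function.update_of_ne hne, Function.update_of_ne hne]
      · rw [Function.update_of_ne (by omega), Function.update_of_ne (by omega)]
      · rw [Function.update_of_ne (by omega), Function.update_of_ne (by omega)]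

/-- The program for a statement that uses the scratch cells from `d` on. -/
def Stmt.compile : Stmt → ℕ → Program
  | skip, _ => .skip
  | store a b, d => .seq (a.compile d) <| .seq (b.compile (d + 1)) <|
      .store (2 * d + 1) (2 * (d + 1) + 1)
  | write a, d => .seq (a.compile d) (.write (2 * d + 1))
  | seq P Q, d => .seq (P.compile d) (Q.compile d)
  | ite a P Q, d => .seq (a.compile d) (.ifNonzero (2 * d + 1) (P.compile d) (Q.compile d))
  | loop r P, d => forProgram r d (P.compile (d + 2))

/-- A bound for the running time of a compiled statement as a function of the loop bound. -/
noncomputable def Stmt.time : Stmt → Polynomial ℕ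
  | skip => 1
  | store a b => a.time + (b.time + 1)
  | write a => a.time + 1
  | seq P Q => P.time + Q.time
  | ite a P Q => a.time + (P.time + Q.time + 1)
  | loop _ P => Polynomial.X * (P.time + 4) + 6

theorem Stmt.runs_compile {x : List ℕ} {N : ℕ} (P : Stmt) (y : (ℕ → ℕ) × List ℕ)
    (ρ g : ℕ → ℕ) (d : ℕ) (hd : 0 < d) (hg : g 0 = N) :
    Runs x (P.compile d) (P.time.eval N) (Represents ρ g d y)
      (Represents ρ g d (P.run x N ρ y)) := by
  have hup : ∀ (g : ℕ → ℕ) d, 0 < d → g 0 = N → ∀ v, Function.update g d v 0 = N :=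
    fun g d hd hg v => by rw [Function.update_of_ne (by omega), hg]
  induction P generalizing y ρ g d with
  | skip =>
    simp only [time, Polynomial.eval_one]
    exact fun σ h => ⟨1, le_rfl, σ, .skip _, h⟩
  | store a b =>
    simp only [time, Polynomial.eval_add, Polynomial.eval_one]
    refine (a.runs_compile y ρ g d hd hg).seq
      ((b.runs_compile y ρ _ (d + 1) (by omega) (hup g d hd hg _)).seq fun σ h =>
        ⟨1, le_rfl, _, .store _ _ _, h.var, fun j hj => ?_, ?_, h.out⟩)
    · simp only
      rw [h.scratch j (by omega), Function.update_of_ne (by omega),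
        Function.update_of_ne (by omega)]
    · simp only [run]
      rw [h.mem, h.scratch _ (by omega), h.scratch _ (by omega), Function.update_self,
        Function.update_of_ne (by omega), Function.update_self]
  | write a =>
    simp only [time, Polynomial.eval_add, Polynomial.eval_one]
    refine (a.runs_compile y ρ g d hd hg).seq fun σ h =>
        ⟨1, le_rfl, _, .write _ _, h.var, fun j hj => ?_, h.mem, ?_⟩
    · simp only
      rw [h.scratch j (by omega), Function.update_of_ne (by omega)]
    · simp only [run]
      rw [h.out, h.scratch _ (by omega), Function.update_self]
  | seq P Q ihP ihQ =>
    simp only [time, Polynomial.eval_add]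
    exact (ihP y ρ g d hd hg).seq (ihQ _ ρ g d hd hg)
  | ite a P Q ihP ihQ =>
    have key : ∀ v, ∀ σ, Represents ρ (Function.update g d v) (d + 1) y σ →
        Represents ρ g d y σ := fun v σ h => (h.mono (by omega)).congr fun j hj => by
      rw [Function.update_of_ne (by omega)]
    simp only [time, Polynomial.eval_add, Polynomial.eval_one]
    refine (a.runs_compile y ρ g d hd hg).seq
      (runs_ifNonzero (a.eval x N y.1 ρ) (fun σ h => ?_) ?_ ?_)
    · rw [h.scratch _ (by omega), Function.update_self]
    · intro h
      refine (ihP y ρ g d hd hg).mono le_rfl (key _) fun σ h' => ?_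
      simpa [run, h] using h'
    · intro h
      refine (ihQ y ρ g d hd hg).mono le_rfl (key _) fun σ h' => ?_
      simpa [run, h] using h'
  | loop r P ih =>
    simp only [time, Polynomial.eval_add, Polynomial.eval_mul, Polynomial.eval_X,
      Polynomial.eval_ofNat]
    refine runs_forProgram hd (fun _ => g)
      (fun n => iterate (fun i z => P.run x N (Function.update ρ r i) z) n y) hg ?_
    intro i hi g' hg'
    refine (ih _ _ g' (d + 2) (by omega) (by rw [hg' 0 hd, hg])).mono le_rfl (fun σ h => h)
      fun σ h => ⟨g', hg', rfl, rfl, h⟩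

/-- The machine program for a statement; the loop bound is the sum of the first two entries of the
input. -/
def Stmt.program (P : Stmt) : Program :=
  .seq (.read (2 * 0 + 1) (2 * 0)) <| .seq (.const (2 * 1 + 1) 1) <|
  .seq (.read (2 * 1 + 1) (2 * 1 + 1)) <| .seq (.add (2 * 0 + 1) (2 * 0 + 1) (2 * 1 + 1)) <|
  P.compile 1

theorem Stmt.outputs_program (P : Stmt) (x : List ℕ) :
    ∃ t ≤ 4 + P.time.eval (x.getD 0 0 + x.getD 1 0),
      P.program.Outputs x t
        (P.run x (x.getD 0 0 + x.getD 1 0) (fun _ => 0) (fun _ => 0, [])).2 := by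
  set y₀ : (ℕ → ℕ) × List ℕ := (fun _ => 0, [])
  set g₀ : ℕ → ℕ := Function.update (fun _ => 0) 0 (x.getD 0 0) with hg₀
  set g₁ : ℕ → ℕ := Function.update (fun _ => 0) 0 (x.getD 0 0 + x.getD 1 0) with hg₁
  have h0 : Represents (fun _ => 0) (fun _ => 0) 0 y₀ State.init :=
    ⟨fun _ => rfl, fun _ _ => rfl, rfl, rfl⟩
  have key : Runs x P.program
      (1 + (1 + (1 + (1 + P.time.eval (x.getD 0 0 + x.getD 1 0)))))
      (Represents (fun _ => 0) (fun _ => 0) 0 y₀)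
      (Represents (fun _ => 0) g₁ 1
        (P.run x (x.getD 0 0 + x.getD 1 0) (fun _ => 0) y₀)) := by
    -- Variable `0` is still zero, so it serves as the address of the first input entry.
    refine .seq (runs_read 0 (fun σ h => h.var 0) fun σ h => h.push _) <|
      .seq (runs_const fun σ h => h.push 1) <|
      .seq (runs_read 1 (fun σ h => ?_) fun σ h => h.set (j := 1) (x.getD 1 0)) <|
      .seq (runs_add (x.getD 0 0) (x.getD 1 0) (fun σ h => ?_) (fun σ h => ?_) fun σ h => ?_) <|
      P.runs_compile y₀ _ g₁ 1 one_pos (by simp [hg₁])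
    · rw [h.scratch 1 (by omega)]; simp
    · rw [h.scratch 0 (by omega)]; simp
    · rw [h.scratch 1 (by omega)]; simp
    · exact ((h.set (j := 0) _).mono (by omega)).congr fun j hj => by
        obtain rfl : j = 0 := by omega
        simp [hg₁]
  obtain ⟨t, ht, τ, h1, h2⟩ := key _ h0
  exact ⟨t, by omega, τ, h1, h2.out⟩

end RAM

theorem Polynomial.eval_mono_nat (p : Polynomial ℕ) {a b : ℕ} (h : a ≤ b) :
    p.eval a ≤ p.eval b := by
  rw [Polynomial.eval_eq_sum, Polynomial.eval_eq_sum]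
  exact Finset.sum_le_sum fun i _ => Nat.mul_le_mul_left _ (Nat.pow_le_pow_left h i)

/-! ### Paths as padded sequences of fixed length -/

namespace CDPInstance

/-- Adjacency in a color, for colors and nodes given as natural numbers. -/
def AdjNat (I : CDPInstance) (i u v : ℕ) : Prop :=
  ∃ (hi : i < I.c) (hu : u < I.n) (hv : v < I.n), (I.graph ⟨i, hi⟩).Adj ⟨u, hu⟩ ⟨v, hv⟩

/-- `w` describes a path from `s` to `t` with at most `k` internal nodes: `w 0` is its color, and
`w 1, …, w k` are its internal nodes, followed by copies of `t`. The case `w 1 = t` is allowed and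
stands for no path. -/
structure IsPadded (I : CDPInstance) (k : ℕ) (w : ℕ → ℕ) : Prop where
  ne_s : ∀ j, 1 ≤ j → j ≤ k → w j ≠ I.s
  inj : ∀ i j, 1 ≤ i → i < j → j ≤ k → w i = w j → w i = I.t
  start : w 1 = I.t ∨ I.AdjNat (w 0) I.s (w 1)
  step : ∀ j, 1 ≤ j → j < k →
    (w j = I.t ∧ w (j + 1) = I.t) ∨ (w j ≠ I.t ∧ I.AdjNat (w 0) (w j) (w (j + 1)))
  last : w k = I.t ∨ I.AdjNat (w 0) (w k) I.t

/-- The paths described by `w` and `w'` have a common internal node. -/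
def Meets (I : CDPInstance) (k : ℕ) (w w' : ℕ → ℕ) : Prop :=
  ∃ i j, (1 ≤ i ∧ i ≤ k) ∧ (1 ≤ j ∧ j ≤ k) ∧ w i = w' j ∧ w i ≠ I.t

/-- The internal nodes of the path described by `w`. -/
def interior (I : CDPInstance) (k : ℕ) (w : ℕ → ℕ) : List ℕ :=
  ((List.range k).map fun j => w (j + 1)).filter (· ≠ (I.t : ℕ))

variable {I : CDPInstance} {k : ℕ} {w w' : ℕ → ℕ}

theorem Meets.symm (h : I.Meets k w w') : I.Meets k w' w := by
  obtain ⟨i, j, hi, hj, h, ht⟩ := h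
  exact ⟨j, i, hj, hi, h.symm, h ▸ ht⟩

theorem mem_interior {v : ℕ} :
    v ∈ I.interior k w ↔ ∃ j, (1 ≤ j ∧ j ≤ k) ∧ w j = v ∧ v ≠ I.t := by
  simp only [interior, List.mem_filter, List.mem_map, List.mem_range, decide_eq_true_eq]
  constructor
  · rintro ⟨⟨j, hj, rfl⟩, hv⟩
    exact ⟨j + 1, ⟨by omega, by omega⟩, rfl, hv⟩
  · rintro ⟨j, ⟨h1, h2⟩, rfl, hv⟩
    exact ⟨⟨j - 1, by omega, by rw [Nat.sub_add_cancel h1]⟩, hv⟩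

theorem IsPadded.eq_t (hw : I.IsPadded k w) {i j : ℕ} (hi : 1 ≤ i) (hij : i ≤ j) (hj : j ≤ k)
    (h : w i = I.t) : w j = I.t := by
  induction j, hij using Nat.le_induction with
  | base => exact h
  | succ j hij ih =>
    rcases hw.step j (by omega) (by omega) with h' | h'
    · exact h'.2
    · exact absurd (ih (by omega)) h'.1

theorem IsPadded.interior_nodup (hw : I.IsPadded k w) : (I.interior k w).Nodup := by
  rw [interior, List.nodup_iff_pairwise_ne, List.pairwise_filter, List.pairwise_map]
  refine List.pairwise_lt_range.imp_of_mem ?_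
  intro i j _ hj hij hi _ h
  simp only [decide_eq_true_eq] at hi
  exact hi (hw.inj (i + 1) (j + 1) (by omega) (by omega) (by simpa using hj) h)

/-- The walk is built backwards from `t`, by induction on the number `d` of slots left; position `k
+ 1` stands for `t` itself. -/
theorem IsPadded.exists_walk (hw : I.IsPadded k w) {i : Fin I.c} (hi : (i : ℕ) = w 0) (d : ℕ) :
    ∀ j, 1 ≤ j → j + d = k + 1 → ∀ u : Fin I.n, (u : ℕ) = (if j ≤ k then w j else I.t) →
    ∃ p : (I.graph i).Walk u I.t, p.support.map Fin.val =
      ((List.range d).map fun e => w (j + e)).filter (· ≠ (I.t : ℕ)) ++ [(I.t : ℕ)] := by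
  induction d with
  | zero =>
    intro j hj hd u hu
    rw [if_neg (by omega)] at hu
    obtain rfl := Fin.ext hu
    exact ⟨.nil, by simp⟩
  | succ d ih =>
    intro j hj hd u hu
    rw [if_pos (by omega)] at hu
    by_cases ht : w j = I.t
    · obtain rfl : u = I.t := Fin.ext (hu.trans ht)
      refine ⟨.nil, ?_⟩
      rw [List.filter_eq_nil_iff.2]
      · simp
      · intro a ha
        obtain ⟨e, he, rfl⟩ := List.mem_map.1 ha
        rw [List.mem_range] at he
        simp [hw.eq_t hj (show j ≤ j + e by omega) (by omega) ht]
    · have hadj : I.AdjNat (w 0) (w j) (if j + 1 ≤ k then w (j + 1) else I.t) := by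
        split_ifs with h
        · exact ((hw.step j hj h).resolve_left fun h => ht h.1).2
        · obtain rfl : j = k := by omega
          exact hw.last.resolve_left ht
      obtain ⟨h1, h2, h3, hadj⟩ := hadj
      obtain ⟨p, hp⟩ := ih (j + 1) (by omega) (by omega) ⟨_, h3⟩ rfl
      obtain rfl : i = ⟨_, h1⟩ := Fin.ext hi
      obtain rfl : u = ⟨_, h2⟩ := Fin.ext hu
      refine ⟨.cons hadj p, ?_⟩
      rw [SimpleGraph.Walk.support_cons, List.map_cons, hp, List.range_succ_eq_map, List.map_cons,
        List.filter_cons_of_pos (by simpa using ht), List.map_map]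
      simp only [add_zero, List.cons_append, List.cons.injEq, true_and]
      congr 2
      refine List.map_congr_left fun e _ => ?_
      simp only [Function.comp_apply]
      congr 1
      omega

/-- The path described by `w`. -/
theorem IsPadded.exists_unicolorPath (hk : 1 ≤ k) (hw : I.IsPadded k w) (h1 : w 1 ≠ I.t) :
    ∃ P : I.UnicolorPath, (P.color : ℕ) = w 0 ∧ P.walk.length ≤ k + 1 ∧
      P.walk.support.map Fin.val = (I.s : ℕ) :: I.interior k w ++ [(I.t : ℕ)] := by
  obtain ⟨hc, hs, hv, hadj⟩ := hw.start.resolve_left h1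
  obtain ⟨p, hp⟩ := hw.exists_walk (i := ⟨w 0, hc⟩) rfl k 1 le_rfl (by omega) ⟨w 1, hv⟩
    (by simp [hk])
  have hsupp : (SimpleGraph.Walk.cons hadj p).support.map Fin.val =
      (I.s : ℕ) :: I.interior k w ++ [(I.t : ℕ)] := by
    rw [SimpleGraph.Walk.support_cons, List.map_cons, hp, interior]
    simp [add_comm]
  refine ⟨⟨_, .cons hadj p, ?_⟩, rfl, ?_, hsupp⟩
  · rw [SimpleGraph.Walk.isPath_def]
    refine List.Nodup.of_map Fin.val ?_
    rw [hsupp, List.cons_append, List.nodup_cons, List.nodup_append]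
    refine ⟨?_, hw.interior_nodup, by simp, ?_⟩
    · rw [List.mem_append, mem_interior, List.mem_singleton]
      rintro (⟨j, hj, h, -⟩ | h)
      · exact hw.ne_s j hj.1 hj.2 h
      · exact I.s_ne_t (Fin.ext h)
    · intro a ha b hb
      rw [List.mem_singleton.1 hb]
      obtain ⟨-, -, -, h⟩ := mem_interior.1 ha
      exact h
  · have := congrArg List.length hsupp
    have h2 : (I.interior k w).length ≤ k :=
      (List.length_filter_le _ _).trans (by simp)
    rw [List.length_map, SimpleGraph.Walk.length_support, List.length_append, List.length_cons,
      List.length_singleton] at this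
    change (SimpleGraph.Walk.cons hadj p).length ≤ k + 1
    omega

/-- The description of a path. -/
def UnicolorPath.pad (P : I.UnicolorPath) (j : ℕ) : ℕ :=
  if j = 0 then P.color else P.walk.getVert j

theorem UnicolorPath.pad_of_pos (P : I.UnicolorPath) {j : ℕ} (hj : 1 ≤ j) :
    P.pad j = P.walk.getVert j := if_neg (by omega)

theorem UnicolorPath.pad_eq_t_iff (P : I.UnicolorPath) {j : ℕ} (hj : 1 ≤ j) :
    P.pad j = I.t ↔ P.walk.length ≤ j := by
  rw [P.pad_of_pos hj, Fin.val_inj]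
  constructor
  · intro h
    by_contra! hlt
    have := P.isPath.getVert_injOn (show j ∈ {i | i ≤ P.walk.length} from hlt.le)
      (by simp)
      (h.trans P.walk.getVert_length.symm)
    omega
  · exact fun h => P.walk.getVert_of_length_le h

theorem UnicolorPath.pad_ne_s (P : I.UnicolorPath) {j : ℕ} (hj : 1 ≤ j) :
    P.pad j ≠ I.s := by
  rcases le_or_gt P.walk.length j with h | h
  · rw [(P.pad_eq_t_iff hj).2 h]
    exact fun h => I.s_ne_t (Fin.ext h.symm)
  · rw [P.pad_of_pos hj, Ne, Fin.val_inj]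
    intro h'
    have := P.isPath.getVert_injOn (show j ∈ {i | i ≤ P.walk.length} from h.le)
      (show 0 ∈ {i | i ≤ P.walk.length} from Nat.zero_le _)
      (h'.trans P.walk.getVert_zero.symm)
    omega

theorem UnicolorPath.adjNat_getVert (P : I.UnicolorPath) {j : ℕ} (hj : j < P.walk.length) :
    I.AdjNat P.color (P.walk.getVert j) (P.walk.getVert (j + 1)) :=
  ⟨P.color.2, (P.walk.getVert j).2, (P.walk.getVert (j + 1)).2, P.walk.adj_getVert_succ hj⟩

theorem UnicolorPath.one_le_length (P : I.UnicolorPath) : 1 ≤ P.walk.length := by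
  by_contra! h
  exact I.s_ne_t (SimpleGraph.Walk.eq_of_length_eq_zero (p := P.walk) (by omega))

theorem UnicolorPath.isPadded_pad (hk : 1 ≤ k) (P : I.UnicolorPath)
    (hP : P.walk.length ≤ k + 1) : I.IsPadded k P.pad where
  ne_s j hj _ := P.pad_ne_s hj
  inj i j hi hij hj h := by
    by_contra hne
    have hlt := mt (P.pad_eq_t_iff hi).2 hne
    rw [h] at hne
    have hlt' := mt (P.pad_eq_t_iff (hi.trans hij.le)).2 hne
    rw [P.pad_of_pos hi, P.pad_of_pos (by omega), Fin.val_inj] at h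
    have := P.isPath.getVert_injOn (show i ∈ {i | i ≤ P.walk.length} by simp; omega)
      (show j ∈ {i | i ≤ P.walk.length} by simp; omega) h
    omega
  start := by
    have := P.adjNat_getVert (j := 0) P.one_le_length
    rw [P.walk.getVert_zero] at this
    exact .inr this
  step j hj hjk := by
    rcases le_or_gt P.walk.length j with h | h
    · exact .inl ⟨(P.pad_eq_t_iff hj).2 h, (P.pad_eq_t_iff (j := j + 1) (by omega)).2 (by omega)⟩
    · refine .inr ⟨fun h' => absurd ((P.pad_eq_t_iff hj).1 h') (by omega), ?_⟩
      rw [P.pad_of_pos hj, P.pad_of_pos (j := j + 1) (by omega)]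
      exact P.adjNat_getVert h
  last := by
    rcases le_or_gt P.walk.length k with h | h
    · exact .inl ((P.pad_eq_t_iff hk).2 h)
    · have := P.adjNat_getVert h
      rw [P.walk.getVert_of_length_le hP, ← P.pad_of_pos hk] at this
      exact .inr this

theorem UnicolorPath.InternallyDisjoint.not_meets {P Q : I.UnicolorPath}
    (h : P.InternallyDisjoint Q) : ¬ I.Meets k P.pad Q.pad := by
  rintro ⟨i, j, hi, hj, h1, h2⟩
  have hs := P.pad_ne_s hi.1
  rw [P.pad_of_pos hi.1] at h1 h2 hs
  rw [Q.pad_of_pos hj.1, Fin.val_inj] at h1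
  rcases h _ (P.walk.getVert_mem_support i) (h1 ▸ Q.walk.getVert_mem_support j) with h | h
  · exact hs (congrArg _ h)
  · exact h2 (congrArg _ h)

/-- Choosing for each path that meets `w` a slot of `w` where it does so is injective, since
disjoint paths cannot share that node, and there are only `k` slots. -/
theorem card_filter_meets_le {α : Type*} (F : Finset α) (f : α → ℕ → ℕ)
    (hF : ∀ a ∈ F, ∀ b ∈ F, a ≠ b → ¬ I.Meets k (f a) (f b)) (w : ℕ → ℕ)
    [DecidablePred fun a => I.Meets k (f a) w] :
    (F.filter fun a => I.Meets k (f a) w).card ≤ k := by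
  have key : ∀ a, ∃ j, I.Meets k (f a) w → (1 ≤ j ∧ j ≤ k) ∧
      ∃ i, (1 ≤ i ∧ i ≤ k) ∧ f a i = w j ∧ f a i ≠ I.t := by
    intro a
    by_cases h : I.Meets k (f a) w
    · obtain ⟨i, j, hi, hj, h1, h2⟩ := h
      exact ⟨j, fun _ => ⟨hj, i, hi, h1, h2⟩⟩
    · exact ⟨0, fun h' => absurd h' h⟩
  choose g hg using key
  calc _ ≤ (Finset.Icc 1 k).card := by
        refine Finset.card_le_card_of_injOn g ?_ ?_
        · intro a ha
          simpa using (hg a (Finset.mem_filter.1 (Finset.mem_coe.1 ha)).2).1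
        · intro a ha b hb hab
          by_contra hne
          have ha' := Finset.mem_filter.1 (Finset.mem_coe.1 ha)
          have hb' := Finset.mem_filter.1 (Finset.mem_coe.1 hb)
          obtain ⟨-, i, hi, h1, h2⟩ := hg a ha'.2
          obtain ⟨-, j, hj, h3, h4⟩ := hg b hb'.2
          exact hF a ha'.1 b hb'.1 hne ⟨i, j, hi, hj, by rw [h1, h3, hab], h2⟩
    _ = k := by simp

/-- The local Hall lemma for the conflict graph of two packings; both degree bounds come from
`card_filter_meets_le`. -/
theorem two_mul_card_le_of_locally_optimal {α β : Type*} [DecidableEq α] [DecidableEq β]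
    (hk : 2 ≤ k) (r : ℕ) (A : Finset α) (B : Finset β) (f : α → ℕ → ℕ) (g : β → ℕ → ℕ)
    (hA : ∀ a ∈ A, ∀ b ∈ A, a ≠ b → ¬ I.Meets k (f a) (f b))
    (hB : ∀ a ∈ B, ∀ b ∈ B, a ≠ b → ¬ I.Meets k (g a) (g b))
    [∀ S : Finset β, DecidablePred fun a => ∃ b ∈ S, I.Meets k (f a) (g b)]
    (hopt : ∀ S ⊆ B, S.card ≤ (k + 1) ^ r →
      S.card ≤ (A.filter fun a => ∃ b ∈ S, I.Meets k (f a) (g b)).card) :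
    r * (2 * B.card) ≤ r * (k * A.card) + A.card := by
  classical
  refine Finset.two_mul_card_le_of_local_hall hk r A B
    (fun b => A.filter fun a => I.Meets k (f a) (g b)) (fun b _ => Finset.filter_subset _ _)
    (fun b _ => card_filter_meets_le A f hA (g b)) ?_ ?_
  · intro a ha
    refine le_trans (Finset.card_le_card ?_) (card_filter_meets_le B g hB (f a))
    intro b hb
    simp only [Finset.mem_filter] at hb ⊢
    exact ⟨hb.1, hb.2.2.symm⟩
  · intro S hS hSc
    refine (hopt S hS hSc).trans (Finset.card_le_card ?_)
    intro a ha
    simp only [Finset.mem_filter, Finset.mem_biUnion] at ha ⊢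
    obtain ⟨ha, b, hb, h⟩ := ha
    exact ⟨b, hb, ha, h⟩

end CDPInstance

/-! ### Conditions and arithmetic as expressions -/

namespace RAM.Expr

/-- The condition expressed by an expression: its value is nonzero. -/
def Holds (x : List ℕ) (N : ℕ) (m ρ : ℕ → ℕ) (e : Expr) : Prop := e.eval x N m ρ ≠ 0

def eq (a b : Expr) : Expr := sub (const 1) (add (sub a b) (sub b a))
def lt (a b : Expr) : Expr := sub b a
def not (a : Expr) : Expr := sub (const 1) a
def and (a b : Expr) : Expr := ite a b (const 0)
def or (a b : Expr) : Expr := add a b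
def indicator (a : Expr) : Expr := ite a (const 1) (const 0)

/-- Unrolled when the program is built: `n` is a constant of the program, unlike the loop bound of
`sum`. -/
def allBelow : ℕ → (ℕ → Expr) → Expr
  | 0, _ => const 1
  | n + 1, f => and (allBelow n f) (f n)

def sumBelow : ℕ → (ℕ → Expr) → Expr
  | 0, _ => const 0
  | n + 1, f => add (sumBelow n f) (f n)

/-- The product of a constant and an expression. -/
def smul (c : ℕ) (a : Expr) : Expr := sumBelow c fun _ => a

/-- The product of two expressions, if the first one is at most the loop bound and the variable `0`
does not occur in them. -/
def mul (a b : Expr) : Expr := sum 0 (ite (lt (var 0) a) b (const 0))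

variable {x : List ℕ} {N : ℕ} {m ρ : ℕ → ℕ} {a b : Expr} {n : ℕ} {f : ℕ → Expr}

@[simp] theorem holds_eq :
    (eq a b).Holds x N m ρ ↔ a.eval x N m ρ = b.eval x N m ρ := by
  simp only [Holds, eq, eval]; omega

@[simp] theorem holds_lt : (lt a b).Holds x N m ρ ↔ a.eval x N m ρ < b.eval x N m ρ := by
  simp only [Holds, lt, eval]; omega

@[simp] theorem holds_not : (not a).Holds x N m ρ ↔ ¬ a.Holds x N m ρ := by
  simp only [Holds, not, eval]; omega

@[simp] theorem holds_and :
    (and a b).Holds x N m ρ ↔ a.Holds x N m ρ ∧ b.Holds x N m ρ := by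
  simp only [Holds, and, eval]; split_ifs <;> simp_all

@[simp] theorem holds_or :
    (or a b).Holds x N m ρ ↔ a.Holds x N m ρ ∨ b.Holds x N m ρ := by
  simp only [Holds, or, eval]; omega

@[simp] theorem holds_allBelow :
    (allBelow n f).Holds x N m ρ ↔ ∀ i < n, (f i).Holds x N m ρ := by
  induction n with
  | zero => simp [allBelow, Holds, eval]
  | succ n ih => simp only [allBelow, holds_and, ih, Nat.forall_lt_succ_right]

@[simp] theorem eval_sumBelow :
    (sumBelow n f).eval x N m ρ = ∑ i ∈ Finset.range n, (f i).eval x N m ρ := by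
  induction n with
  | zero => simp [sumBelow, eval]
  | succ n ih => simp only [sumBelow, eval, ih, Finset.sum_range_succ]

@[simp] theorem holds_sumBelow :
    (sumBelow n f).Holds x N m ρ ↔ ∃ i < n, (f i).Holds x N m ρ := by
  simp [Holds]

@[simp] theorem eval_smul {c : ℕ} : (smul c a).eval x N m ρ = c * a.eval x N m ρ := by
  simp [smul]

theorem eval_indicator [Decidable (a.Holds x N m ρ)] :
    (indicator a).eval x N m ρ = if a.Holds x N m ρ then 1 else 0 := by
  simp only [indicator, eval, Holds]
  congr

theorem eval_sum_indicator {r : ℕ} {p : ℕ → Prop} [DecidablePred p]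
    (hp : ∀ i < N, a.Holds x N m (Function.update ρ r i) ↔ p i) :
    (sum r (indicator a)).eval x N m ρ = ((Finset.range N).filter p).card := by
  classical
  rw [eval, Finset.card_filter]
  refine Finset.sum_congr rfl fun i hi => ?_
  rw [eval_indicator]
  simp only [hp i (Finset.mem_range.1 hi)]

theorem eval_sumBelow_indicator {p : ℕ → Prop} [DecidablePred p]
    (hp : ∀ i < n, (f i).Holds x N m ρ ↔ p i) :
    (sumBelow n fun i => indicator (f i)).eval x N m ρ = ((Finset.range n).filter p).card := by
  classical
  rw [eval_sumBelow, Finset.card_filter]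
  refine Finset.sum_congr rfl fun i hi => ?_
  rw [eval_indicator]
  simp only [hp i (Finset.mem_range.1 hi)]

/-- The value of `a` does not depend on the variable `0`. -/
def IgnoresZero (a : Expr) : Prop :=
  ∀ x N m ρ i, a.eval x N m (Function.update ρ 0 i) = a.eval x N m ρ

theorem IgnoresZero.add (ha : a.IgnoresZero) (hb : b.IgnoresZero) : (add a b).IgnoresZero := by
  intro x N m ρ i
  simp only [eval, ha x N m ρ i, hb x N m ρ i]

theorem ignoresZero_mul : (mul a b).IgnoresZero := by
  intro x N m ρ i
  simp only [mul, eval, Function.update_idem]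

theorem ignoresZero_var {i : ℕ} (hi : i ≠ 0) : (var i).IgnoresZero :=
  fun _ _ _ _ _ => Function.update_of_ne hi _ _

theorem eval_mul (ha : a.IgnoresZero) (hb : b.IgnoresZero) (h : a.eval x N m ρ ≤ N) :
    (mul a b).eval x N m ρ = a.eval x N m ρ * b.eval x N m ρ := by
  have : ∀ i, (lt (var 0) a).eval x N m (Function.update ρ 0 i) ≠ 0 ↔ i < a.eval x N m ρ := by
    intro i
    simp only [lt, eval, ha x N m ρ i, Function.update_self]
    omega
  simp only [mul, eval, this, hb x N m ρ]
  rw [← Finset.sum_filter, Finset.sum_const, smul_eq_mul]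
  congr 1
  rw [show (Finset.range N).filter (· < a.eval x N m ρ) = Finset.range (a.eval x N m ρ) by
    ext i; simp; omega, Finset.card_range]

end RAM.Expr

/-! ### Addresses in the input array -/

theorem List.length_flatMap_const {α β : Type*} (f : α → List β) (L : ℕ) (l : List α)
    (hf : ∀ a ∈ l, (f a).length = L) : (l.flatMap f).length = l.length * L := by
  induction l with
  | nil => simp
  | cons a l ih =>
    rw [List.flatMap_cons, List.length_append, hf a (by simp), ih fun b hb => hf b (by simp [hb]),
      List.length_cons, add_mul, one_mul, add_comm]

theorem List.getD_flatMap_const {α β : Type*} (f : α → List β) (L : ℕ) (d : β) (l : List α)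
    (hf : ∀ a ∈ l, (f a).length = L) (i j : ℕ) (hi : i < l.length) (hj : j < L) :
    (l.flatMap f).getD (L * i + j) d = (f l[i]).getD j d := by
  induction l generalizing i with
  | nil => simp at hi
  | cons a l ih =>
    have ha := hf a (by simp)
    cases i with
    | zero =>
      rw [List.flatMap_cons, mul_zero, zero_add, List.getD_append _ _ _ _ (by omega)]
      rfl
    | succ i =>
      rw [List.flatMap_cons, List.getD_append_right _ _ _ _ (by rw [ha, mul_add]; omega), ha,
        show L * (i + 1) + j - L = L * i + j by rw [mul_add]; omega,
        ih (fun b hb => hf b (by simp [hb])) i (by simpa using hi)]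
      rfl

namespace CDPInstance

variable {I : CDPInstance}

theorem length_encode : I.encode.length = 4 + I.c * (I.n * I.n) := by
  classical
  rw [encode, List.length_append, List.length_flatMap_const _ (I.n * I.n), List.length_finRange]
  · rfl
  · intro i _
    rw [List.length_flatMap_const _ I.n, List.length_finRange]
    intro u _
    rw [List.length_map, List.length_finRange]

theorem getD_encode_add_four (i u v : ℕ) (hi : i < I.c) (hu : u < I.n) (hv : v < I.n) :
    I.encode.getD (4 + (I.n * (I.n * i + u) + v)) 0 ≠ 0 ↔ I.AdjNat i u v := by
  classical
  have huv : I.n * u + v < I.n * I.n := by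
    calc _ < I.n * (u + 1) := by rw [mul_add]; omega
      _ ≤ _ := Nat.mul_le_mul_left _ hu
  rw [encode, List.getD_append_right _ _ _ _ (by simp),
    show 4 + (I.n * (I.n * i + u) + v) - [I.n, I.c, (I.s : ℕ), (I.t : ℕ)].length =
      I.n * I.n * i + (I.n * u + v) by simp; ring,
    List.getD_flatMap_const _ (I.n * I.n) _ _ _ i _ (by simpa) huv,
    List.getD_flatMap_const _ I.n _ _ _ u v (by simpa) hv]
  · rw [List.getD_eq_getElem _ _ (by simpa)]
    simp [AdjNat, hi, hu, hv]
  · simp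
  · intro i _
    rw [List.length_flatMap_const _ I.n] <;> simp

theorem two_le_n : 2 ≤ I.n := by
  have := I.s.2
  have := I.t.2
  have : (I.s : ℕ) ≠ I.t := fun h => I.s_ne_t (Fin.ext h)
  omega

/-- The left side is the loop bound, so a polynomial time bound in it becomes one in the input size.
-/
theorem n_add_c_le_length_encode : I.n + I.c ≤ I.encode.length := by
  rw [length_encode]
  have h1 := I.two_le_n
  have h2 := I.c_pos
  have h3 : I.c + I.n ≤ I.c * I.n + 1 := by nlinarith
  have h4 : I.c * I.n ≤ I.c * (I.n * I.n) := Nat.mul_le_mul_left _ (by nlinarith)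
  omega

end CDPInstance

/-! ### Testing adjacency -/

namespace LCDP

open RAM RAM.Expr

/-- The number of nodes of the instance. -/
def nExpr : Expr := read (const 0)
/-- The number of colors of the instance. -/
def cExpr : Expr := read (const 1)
def sExpr : Expr := read (const 2)
def tExpr : Expr := read (const 3)

/-- The range checks matter: an out-of-range node would address an entry of another row or matrix.
`nExpr` is the left factor of each product because `mul` needs that factor to be at most the loop
bound. -/
def adjExpr (i u v : Expr) : Expr :=
  Expr.and (lt i cExpr) <| Expr.and (lt u nExpr) <| Expr.and (lt v nExpr) <|
    read (add (const 4) (add (mul nExpr (add (mul nExpr i) u)) v))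

variable {I : CDPInstance} {m ρ : ℕ → ℕ}

/-- The loop bound on the instance `I`. -/
abbrev bound (I : CDPInstance) : ℕ := I.n + I.c

@[simp] theorem eval_nExpr {N : ℕ} : nExpr.eval I.encode N m ρ = I.n := rfl
@[simp] theorem eval_cExpr {N : ℕ} : cExpr.eval I.encode N m ρ = I.c := rfl
@[simp] theorem eval_sExpr {N : ℕ} : sExpr.eval I.encode N m ρ = I.s := rfl
@[simp] theorem eval_tExpr {N : ℕ} : tExpr.eval I.encode N m ρ = I.t := rfl

theorem ignoresZero_nExpr : nExpr.IgnoresZero := fun _ _ _ _ _ => rfl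
theorem ignoresZero_sExpr : sExpr.IgnoresZero := fun _ _ _ _ _ => rfl

theorem holds_adjExpr {i u v : Expr} (hi : i.IgnoresZero) (hu : u.IgnoresZero) :
    (adjExpr i u v).Holds I.encode (bound I) m ρ ↔
      I.AdjNat (i.eval I.encode (bound I) m ρ) (u.eval I.encode (bound I) m ρ)
        (v.eval I.encode (bound I) m ρ) := by
  have h1 : (mul nExpr i).eval I.encode (bound I) m ρ = I.n * i.eval I.encode (bound I) m ρ := by
    rw [eval_mul ignoresZero_nExpr hi (by simp), eval_nExpr]
  have h2 : (mul nExpr (add (mul nExpr i) u)).eval I.encode (bound I) m ρ =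
      I.n * (I.n * i.eval I.encode (bound I) m ρ + u.eval I.encode (bound I) m ρ) := by
    rw [eval_mul ignoresZero_nExpr (ignoresZero_mul.add hu) (by simp), eval_nExpr, eval, h1]
  simp only [adjExpr, holds_and, holds_lt, eval_cExpr, eval_nExpr]
  constructor
  · rintro ⟨h3, h4, h5, h6⟩
    rw [Holds, eval, eval, eval, eval, h2] at h6
    exact (CDPInstance.getD_encode_add_four _ _ _ h3 h4 h5).1 h6
  · intro h
    have := h
    obtain ⟨h3, h4, h5, -⟩ := h
    refine ⟨h3, h4, h5, ?_⟩
    rw [Holds, eval, eval, eval, eval, h2]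
    exact (CDPInstance.getD_encode_add_four _ _ _ h3 h4 h5).2 this

end LCDP

/-! ### The local search program -/

namespace LCDP

open RAM RAM.Expr

/-- Consecutive execution of the statements `f 0, …, f (n - 1)`. -/
def seqBelow : ℕ → (ℕ → Stmt) → Stmt
  | 0, _ => .skip
  | n + 1, f => .seq (seqBelow n f) (f n)

/-- Slot `j` of candidate `i`. -/
def candExpr (k i j : ℕ) : Expr := var (2 + ((k + 1) * i + j))

/-- Cell `j` of the table entry whose index is variable `1`. -/
def tableExpr (k j : ℕ) : Expr := load (add (smul (k + 1) (var 1)) (const j))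

def paddedExpr (k : ℕ) (f : ℕ → Expr) : Expr :=
  Expr.and (allBelow k fun j => Expr.not (Expr.eq (f (j + 1)) sExpr)) <|
  Expr.and (allBelow k fun j => allBelow j fun i =>
    Expr.or (Expr.not (Expr.eq (f (i + 1)) (f (j + 1)))) (Expr.eq (f (i + 1)) tExpr)) <|
  Expr.and (Expr.or (Expr.eq (f 1) tExpr) (adjExpr (f 0) sExpr (f 1))) <|
  Expr.and (allBelow (k - 1) fun j => Expr.or
    (Expr.and (Expr.eq (f (j + 1)) tExpr) (Expr.eq (f (j + 2)) tExpr))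
    (Expr.and (Expr.not (Expr.eq (f (j + 1)) tExpr)) (adjExpr (f 0) (f (j + 1)) (f (j + 2))))) <|
  Expr.or (Expr.eq (f k) tExpr) (adjExpr (f 0) (f k) tExpr)

def meetsExpr (k : ℕ) (f g : ℕ → Expr) : Expr :=
  sumBelow k fun i => sumBelow k fun j =>
    Expr.and (Expr.eq (f (i + 1)) (g (j + 1))) (Expr.not (Expr.eq (f (i + 1)) tExpr))

/-- The table entry given by variable `1` is present and meets a candidate. -/
def hitExpr (k P : ℕ) : Expr :=
  Expr.and (tableExpr k 0) (sumBelow P fun i => meetsExpr k (tableExpr k) (candExpr k i))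

def realExpr (k i : ℕ) : Expr := Expr.not (Expr.eq (candExpr k i 1) tExpr)

/-- The candidates are disjoint paths, and there are more of them than table entries they meet. -/
def improvingExpr (k P : ℕ) : Expr :=
  Expr.and (allBelow P fun i => paddedExpr k (candExpr k i)) <|
  Expr.and (allBelow P fun j => allBelow j fun i =>
    Expr.not (meetsExpr k (candExpr k i) (candExpr k j))) <|
  lt (sum 1 (indicator (hitExpr k P))) (sumBelow P fun i => indicator (realExpr k i))

/-- Only the color cell is reset; the nodes of a deleted entry stay in memory, but are no longer
read as a path. -/
def clearStmt (k P : ℕ) : Stmt :=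
  .loop 1 (.ite (hitExpr k P) (.store (smul (k + 1) (var 1)) (const 0)) .skip)

/-- The address comes from the first internal node, and the color is stored increased by one so that
zero can mean absence. -/
def insertStmt (k i : ℕ) : Stmt :=
  seqBelow (k + 1) fun j => .store (add (smul (k + 1) (candExpr k i 1)) (const j))
    (if j = 0 then add (candExpr k i 0) (const 1) else candExpr k i j)

def insertAllStmt (k P : ℕ) : Stmt :=
  seqBelow P fun i => .ite (realExpr k i) (insertStmt k i) .skip

def improveStmt (k P : ℕ) : Stmt :=
  .ite (improvingExpr k P) (.seq (clearStmt k P) (insertAllStmt k P)) .skip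

/-- Loops over all values of the variables `2, …, q + 1`. -/
def loops : ℕ → Stmt → Stmt
  | 0, B => B
  | q + 1, B => .loop (2 + q) (loops q B)

/-- The outer variable merely counts passes; its reuse as a table index inside is harmless because
every loop and sum restores its variable. -/
def searchStmt (k P : ℕ) : Stmt := .loop 1 (loops ((k + 1) * P) (improveStmt k P))

def outputDirectStmt : Stmt :=
  .loop 1 <| .ite (adjExpr (var 1) sExpr tExpr)
    (.seq (.write (var 1)) <| .seq (.write (const 2)) <| .seq (.write sExpr) (.write tExpr)) .skip

def outputTableStmt (k : ℕ) : Stmt :=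
  .loop 1 <| .ite (tableExpr k 0)
    (.seq (.write (sub (tableExpr k 0) (const 1))) <|
      .seq (.write (add (const 2)
        (sumBelow k fun j => indicator (Expr.not (Expr.eq (tableExpr k (j + 1)) tExpr))))) <|
      .seq (.write sExpr) <|
      .seq (seqBelow k fun j => .ite (Expr.not (Expr.eq (tableExpr k (j + 1)) tExpr))
        (.write (tableExpr k (j + 1))) .skip)
      (.write tExpr)) .skip

/-- Local search for disjoint paths with at most `k` internal nodes that replaces sets of paths by
larger sets of at most `P` paths. -/
def mainStmt (k P : ℕ) : Stmt :=
  .seq (searchStmt k P) (.seq outputDirectStmt (outputTableStmt k))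

/-! ### Meaning of the conditions -/

/-- The candidates given by the variables. -/
def cand (k : ℕ) (ρ : ℕ → ℕ) (i j : ℕ) : ℕ := ρ (2 + ((k + 1) * i + j))

/-- The table has an entry with index `v`. -/
def Present (k : ℕ) (m : ℕ → ℕ) (v : ℕ) : Prop := m ((k + 1) * v) ≠ 0

/-- The path with index `v` in the table. -/
def entry (k : ℕ) (m : ℕ → ℕ) (v j : ℕ) : ℕ :=
  if j = 0 then m ((k + 1) * v) - 1 else m ((k + 1) * v + j)

/-- The table entry `v` is present and meets a candidate. -/
def Hit (I : CDPInstance) (k P : ℕ) (m : ℕ → ℕ) (W : ℕ → ℕ → ℕ) (v : ℕ) : Prop :=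
  Present k m v ∧ ∃ i < P, I.Meets k (entry k m v) (W i)

open scoped Classical in
/-- Inserting the candidates `W` improves the table. -/
def Improving (I : CDPInstance) (k P : ℕ) (m : ℕ → ℕ) (W : ℕ → ℕ → ℕ) : Prop :=
  (∀ i < P, I.IsPadded k (W i)) ∧ (∀ j < P, ∀ i < j, ¬ I.Meets k (W i) (W j)) ∧
    ((Finset.range (bound I)).filter (Hit I k P m W)).card <
      ((Finset.range P).filter fun i => W i 1 ≠ I.t).card

variable {I : CDPInstance} {k P : ℕ} {m ρ : ℕ → ℕ}

theorem meets_congr {f f' g g' : ℕ → ℕ} (hf : ∀ j, 1 ≤ j → j ≤ k → f j = f' j)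
    (hg : ∀ j, 1 ≤ j → j ≤ k → g j = g' j) : I.Meets k f g ↔ I.Meets k f' g' := by
  have key : ∀ {f f' g g' : ℕ → ℕ} (hf : ∀ j, 1 ≤ j → j ≤ k → f j = f' j)
      (hg : ∀ j, 1 ≤ j → j ≤ k → g j = g' j), I.Meets k f g → I.Meets k f' g' := by
    rintro f f' g g' hf hg ⟨i, j, hi, hj, h, ht⟩
    refine ⟨i, j, hi, hj, ?_, ?_⟩
    · rw [← hf i hi.1 hi.2, ← hg j hj.1 hj.2, h]
    · rwa [← hf i hi.1 hi.2]
  exact ⟨key hf hg, key (fun j h1 h2 => (hf j h1 h2).symm) fun j h1 h2 => (hg j h1 h2).symm⟩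

theorem isPadded_congr (hk : 1 ≤ k) {f f' : ℕ → ℕ} (hf : ∀ j ≤ k, f j = f' j)
    (h : I.IsPadded k f) : I.IsPadded k f' where
  ne_s j h1 h2 := hf j h2 ▸ h.ne_s j h1 h2
  inj i j h1 h2 h3 := by
    rw [← hf i (by omega), ← hf j h3]
    exact h.inj i j h1 h2 h3
  start := by
    rw [← hf 0 (by omega), ← hf 1 hk]
    exact h.start
  step j h1 h2 := by
    rw [← hf 0 (by omega), ← hf j (by omega), ← hf (j + 1) (by omega)]
    exact h.step j h1 h2
  last := by
    rw [← hf 0 (by omega), ← hf k le_rfl]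
    exact h.last

theorem holds_meetsExpr {f g : ℕ → Expr} {x : List ℕ} {N : ℕ} {u w : ℕ → ℕ}
    (hx : x = I.encode)
    (hf : ∀ j, 1 ≤ j → j ≤ k → (f j).eval x N m ρ = u j)
    (hg : ∀ j, 1 ≤ j → j ≤ k → (g j).eval x N m ρ = w j) :
    (meetsExpr k f g).Holds x N m ρ ↔ I.Meets k u w := by
  subst hx
  simp only [meetsExpr, holds_sumBelow, holds_and, holds_eq, holds_not, eval_tExpr]
  constructor
  · rintro ⟨i, hi, j, hj, h1, h2⟩
    rw [hf _ (by omega) (by omega)] at h1 h2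
    rw [hg _ (by omega) (by omega)] at h1
    exact ⟨i + 1, j + 1, by omega, by omega, h1, h2⟩
  · rintro ⟨i, j, hi, hj, h1, h2⟩
    refine ⟨i - 1, by omega, j - 1, by omega, ?_⟩
    rw [Nat.sub_add_cancel hi.1, Nat.sub_add_cancel hj.1, hf i hi.1 hi.2, hg j hj.1 hj.2]
    exact ⟨h1, h2⟩

theorem eval_candExpr {x : List ℕ} {N i j : ℕ} :
    (candExpr k i j).eval x N m ρ = cand k ρ i j := rfl

theorem eval_tableExpr {x : List ℕ} {N j : ℕ} :
    (tableExpr k j).eval x N m ρ = m ((k + 1) * ρ 1 + j) := by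
  simp [tableExpr, eval]

theorem eval_tableExpr_of_pos {x : List ℕ} {N j : ℕ} (hj : 1 ≤ j) :
    (tableExpr k j).eval x N m ρ = entry k m (ρ 1) j := by
  rw [eval_tableExpr, entry, if_neg (by omega)]

theorem holds_paddedExpr {i : ℕ} (hk : 1 ≤ k) :
    (paddedExpr k (candExpr k i)).Holds I.encode (bound I) m ρ ↔ I.IsPadded k (cand k ρ i) := by
  have hz : ∀ j, (candExpr k i j).IgnoresZero := fun j => ignoresZero_var (by omega)
  simp only [paddedExpr, holds_and, holds_allBelow, holds_not, holds_or, holds_eq,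
    holds_adjExpr (hz _) (hz _), holds_adjExpr (hz _) ignoresZero_sExpr,
    eval_sExpr, eval_tExpr, eval_candExpr]
  constructor
  · rintro ⟨h1, h2, h3, h4, h5⟩
    refine ⟨fun j hj hjk => ?_, fun a b ha hab hb h => ?_, h3, fun j hj hjk => ?_, h5⟩
    · have := h1 (j - 1) (by omega)
      rwa [Nat.sub_add_cancel hj] at this
    · have := h2 (b - 1) (by omega) (a - 1) (by omega)
      rw [Nat.sub_add_cancel ha, Nat.sub_add_cancel (by omega)] at this
      exact this.resolve_left fun h' => h' h
    · have := h4 (j - 1) (by omega)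
      rwa [show j - 1 + 2 = j + 1 by omega, Nat.sub_add_cancel hj] at this
  · intro h
    refine ⟨fun j hj => h.ne_s _ (by omega) (by omega), fun b hb a hab => ?_, h.start,
      fun j hj => h.step (j + 1) (by omega) (by omega), h.last⟩
    exact or_iff_not_imp_left.2 fun h' =>
      h.inj (a + 1) (b + 1) (by omega) (by omega) (by omega) (not_not.1 h')

theorem holds_hitExpr {N : ℕ} :
    (hitExpr k P).Holds I.encode N m ρ ↔ Hit I k P m (cand k ρ) (ρ 1) := by
  rw [hitExpr, holds_and, holds_sumBelow, Holds, eval_tableExpr, add_zero]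
  refine and_congr Iff.rfl (exists_congr fun i => and_congr Iff.rfl ?_)
  exact holds_meetsExpr rfl (fun j h1 _ => eval_tableExpr_of_pos h1) fun j _ _ => rfl

theorem cand_update_one {v : ℕ} : cand k (Function.update ρ 1 v) = cand k ρ := by
  funext i j
  rw [cand, cand, Function.update_of_ne (by omega)]

theorem holds_improvingExpr (hk : 1 ≤ k) :
    (improvingExpr k P).Holds I.encode (bound I) m ρ ↔ Improving I k P m (cand k ρ) := by
  classical
  rw [improvingExpr, holds_and, holds_and, holds_lt, holds_allBelow, holds_allBelow, Improving,
    eval_sum_indicator (p := Hit I k P m (cand k ρ)),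
    eval_sumBelow_indicator (p := fun i => cand k ρ i 1 ≠ I.t)]
  · simp only [holds_allBelow, holds_not, holds_paddedExpr hk]
    refine and_congr Iff.rfl (and_congr (forall₄_congr fun j _ i _ => not_congr ?_) ?_)
    · exact holds_meetsExpr rfl (fun _ _ _ => rfl) fun _ _ _ => rfl
    · congr!
  · intro i _
    simp [realExpr, eval_candExpr]
  · intro v _
    rw [holds_hitExpr, cand_update_one, Function.update_self]

/-! ### Meaning of the updates -/

theorem address_inj {v v' j j' : ℕ} (hj : j ≤ k) (hj' : j' ≤ k)
    (h : (k + 1) * v + j = (k + 1) * v' + j') : v = v' ∧ j = j' := by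
  have h1 := congrArg (· / (k + 1)) h
  have h2 := congrArg (· % (k + 1)) h
  simp only [Nat.mul_add_div (Nat.succ_pos k), Nat.mul_add_mod] at h1 h2
  rw [Nat.div_eq_of_lt (by omega), Nat.div_eq_of_lt (by omega)] at h1
  rw [Nat.mod_eq_of_lt (by omega), Nat.mod_eq_of_lt (by omega)] at h2
  exact ⟨by omega, h2⟩

theorem run_ite {x : List ℕ} {N : ℕ} {a : Expr} {B C : Stmt} {y : (ℕ → ℕ) × List ℕ}
    [Decidable (a.Holds x N y.1 ρ)] :
    (Stmt.ite a B C).run x N ρ y = if a.Holds x N y.1 ρ then B.run x N ρ y else C.run x N ρ y := by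
  simp only [Stmt.run, Holds]
  congr

theorem run_clearStmt (o : List ℕ) :
    ∃ m₁, (clearStmt k P).run I.encode (bound I) ρ (m, o) = (m₁, o) ∧
    ∀ v, (v < bound I → Hit I k P m (cand k ρ) v → m₁ ((k + 1) * v) = 0) ∧
      (¬ Hit I k P m (cand k ρ) v → m₁ ((k + 1) * v) = m ((k + 1) * v)) ∧
      ∀ j, 1 ≤ j → j ≤ k → m₁ ((k + 1) * v + j) = m ((k + 1) * v + j) := by
  classical
  suffices ∀ b, ∃ m₁, iterate (fun v z => (Stmt.ite (hitExpr k P)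
      (.store (smul (k + 1) (var 1)) (const 0)) .skip).run I.encode (bound I)
        (Function.update ρ 1 v) z) b (m, o) = (m₁, o) ∧
      ∀ v, (v < b → Hit I k P m (cand k ρ) v → m₁ ((k + 1) * v) = 0) ∧
      ((¬ Hit I k P m (cand k ρ) v ∨ b ≤ v) → m₁ ((k + 1) * v) = m ((k + 1) * v)) ∧
      ∀ j, 1 ≤ j → j ≤ k → m₁ ((k + 1) * v + j) = m ((k + 1) * v + j) by
    obtain ⟨m₁, h1, h2⟩ := this (bound I)
    exact ⟨m₁, h1, fun v => ⟨(h2 v).1, fun h => (h2 v).2.1 (.inl h), (h2 v).2.2⟩⟩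
  intro b
  induction b with
  | zero => exact ⟨m, rfl, fun v => ⟨by omega, fun _ => rfl, fun _ _ _ => rfl⟩⟩
  | succ b ih =>
    obtain ⟨m₁, h1, h2⟩ := ih
    -- The test in round `b` reads only entry `b`, which earlier rounds left alone.
    have hhit : Hit I k P m₁ (cand k ρ) b ↔ Hit I k P m (cand k ρ) b := by
      refine and_congr ?_ (exists_congr fun i => and_congr Iff.rfl
        (meets_congr (fun j hj hjk => ?_) fun _ _ _ => rfl))
      · rw [Present, Present, (h2 b).2.1 (.inr le_rfl)]
      · rw [entry, entry, if_neg (by omega), if_neg (by omega), (h2 b).2.2 j hj hjk]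
    rw [iterate, h1, run_ite]
    simp only [holds_hitExpr, cand_update_one, Function.update_self, hhit]
    split_ifs with h
    · refine ⟨_, rfl, fun v => ?_⟩
      simp only [eval_smul, eval, Function.update_self]
      refine ⟨fun hv hhv => ?_, fun hv => ?_, fun j hj hjk => ?_⟩
      · rcases eq_or_ne v b with rfl | hne
        · rw [Function.update_self]
        · rw [Function.update_of_ne (show (k + 1) * v ≠ (k + 1) * b from fun h' => hne
            (address_inj (k := k) (j := 0) (j' := 0) (by omega) (by omega) h').1)]
          exact (h2 v).1 (by omega) hhv
      · rw [Function.update_of_ne]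
        · exact (h2 v).2.1 (hv.imp_right fun h => by omega)
        · intro h'
          obtain rfl := (address_inj (k := k) (j := 0) (j' := 0) (by omega) (by omega) h').1
          rcases hv with hv | hv
          · exact hv h
          · omega
      · rw [Function.update_of_ne]
        · exact (h2 v).2.2 j hj hjk
        · intro h'
          have := (address_inj (k := k) (j' := 0) hjk (by omega) h').2
          omega
    · refine ⟨m₁, rfl, fun v => ⟨fun hv hhv => ?_, fun hv =>
        (h2 v).2.1 (hv.imp_right fun h => by omega), (h2 v).2.2⟩⟩
      rcases eq_or_ne v b with rfl | hne
      · exact absurd hhv h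
      · exact (h2 v).1 (by omega) hhv

theorem run_seqBelow {x : List ℕ} {N n : ℕ} {f : ℕ → Stmt} {y : (ℕ → ℕ) × List ℕ} :
    (seqBelow n f).run x N ρ y = iterate (fun j z => (f j).run x N ρ z) n y := by
  induction n with
  | zero => rfl
  | succ n ih => rw [seqBelow, Stmt.run, ih, iterate]

theorem run_insertStmt {x : List ℕ} {N : ℕ} (i : ℕ) (o : List ℕ) :
    ∃ m', (insertStmt k i).run x N ρ (m, o) = (m', o) ∧
      (∀ j ≤ k, m' ((k + 1) * cand k ρ i 1 + j) = cand k ρ i j + if j = 0 then 1 else 0) ∧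
      ∀ v ≠ cand k ρ i 1, ∀ j ≤ k, m' ((k + 1) * v + j) = m ((k + 1) * v + j) := by
  suffices ∀ b ≤ k + 1, ∃ m', iterate (fun j z => (Stmt.store
      (add (smul (k + 1) (candExpr k i 1)) (const j))
      (if j = 0 then add (candExpr k i 0) (const 1) else candExpr k i j)).run x N ρ z) b
        (m, o) = (m', o) ∧
      (∀ j < b, m' ((k + 1) * cand k ρ i 1 + j) = cand k ρ i j + if j = 0 then 1 else 0) ∧
      ∀ v ≠ cand k ρ i 1, ∀ j ≤ k, m' ((k + 1) * v + j) = m ((k + 1) * v + j) by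
    obtain ⟨m', h1, h2, h3⟩ := this (k + 1) le_rfl
    exact ⟨m', by rw [insertStmt, run_seqBelow, h1], fun j hj => h2 j (by omega), h3⟩
  intro b
  induction b with
  | zero => exact fun _ => ⟨m, rfl, by omega, fun _ _ _ _ => rfl⟩
  | succ b ih =>
    intro hb
    obtain ⟨m', h1, h2, h3⟩ := ih (by omega)
    rw [iterate, h1]
    refine ⟨_, rfl, fun j hj => ?_, fun v hv j hj => ?_⟩
    · simp only [eval, eval_smul, eval_candExpr]
      rcases eq_or_ne j b with rfl | hne
      · rw [Function.update_self]
        split_ifs with h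
        · subst h; rfl
        · rfl
      · rw [Function.update_of_ne (by omega)]
        exact h2 j (by omega)
    · simp only [eval, eval_smul, eval_candExpr]
      rw [Function.update_of_ne, h3 v hv j hj]
      exact fun h' => hv (address_inj hj (by omega) h').1

/-- By `hinj`, a later candidate never overwrites the entry of an earlier one. -/
theorem run_insertAllStmt {N : ℕ} (o : List ℕ)
    (hinj : ∀ j < P, ∀ i < j, cand k ρ i 1 ≠ I.t → cand k ρ i 1 ≠ cand k ρ j 1) :
    ∃ m₂, (insertAllStmt k P).run I.encode N ρ (m, o) = (m₂, o) ∧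
      (∀ i < P, cand k ρ i 1 ≠ I.t → ∀ j ≤ k,
        m₂ ((k + 1) * cand k ρ i 1 + j) = cand k ρ i j + if j = 0 then 1 else 0) ∧
      ∀ v, (∀ i < P, cand k ρ i 1 ≠ I.t → cand k ρ i 1 ≠ v) → ∀ j ≤ k,
        m₂ ((k + 1) * v + j) = m ((k + 1) * v + j) := by
  classical
  induction P with
  | zero => exact ⟨m, rfl, by omega, fun _ _ _ _ => rfl⟩
  | succ P ih =>
    obtain ⟨m₁, h1, h2, h3⟩ := ih fun j hj => hinj j (by omega)
    rw [insertAllStmt, seqBelow, Stmt.run, ← insertAllStmt, h1, run_ite]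
    have hreal : (realExpr k P).Holds I.encode N m₁ ρ ↔ cand k ρ P 1 ≠ I.t := by
      simp [realExpr, eval_candExpr]
    simp only [hreal]
    split_ifs with h
    · obtain ⟨m₂, k1, k2, k3⟩ := run_insertStmt (x := I.encode) (N := N) (k := k) (ρ := ρ)
        (m := m₁) P o
      refine ⟨m₂, k1, fun i hi hr j hj => ?_, fun v hv j hj => ?_⟩
      · rcases eq_or_ne i P with rfl | hne
        · exact k2 j hj
        · rw [k3 _ (hinj P (by omega) i (by omega) hr) j hj]
          exact h2 i (by omega) hr j hj
      · rw [k3 v (hv P (by omega) h).symm j hj]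
        exact h3 v (fun i hi => hv i (by omega)) j hj
    · refine ⟨m₁, rfl, fun i hi hr j hj => ?_, fun v hv => h3 v fun i hi => hv i (by omega)⟩
      obtain hi | rfl : i < P ∨ i = P := by omega
      · exact h2 i hi hr j hj
      · exact absurd hr h

/-! ### Local search -/

/-- The table describes disjoint paths, each of them indexed by its first internal node. -/
def Valid (I : CDPInstance) (k : ℕ) (m : ℕ → ℕ) : Prop :=
  ∀ v, Present k m v → I.IsPadded k (entry k m v) ∧ entry k m v 1 = v ∧ v ≠ I.t ∧
    ∀ v' ≠ v, Present k m v' → ¬ I.Meets k (entry k m v) (entry k m v')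

open scoped Classical in
/-- The indices of the paths in the table. -/
noncomputable def indices (I : CDPInstance) (k : ℕ) (m : ℕ → ℕ) : Finset ℕ :=
  (Finset.range (bound I)).filter (Present k m)

theorem mem_indices_iff {v : ℕ} :
    v ∈ indices I k m ↔ v < bound I ∧ Present k m v := by
  classical
  rw [indices, Finset.mem_filter, Finset.mem_range]

theorem Valid.lt_n (h : Valid I k m) {v : ℕ} (hv : Present k m v) : v < I.n := by
  obtain ⟨h1, h2, h3, -⟩ := h v hv
  have := h1.start
  rw [h2] at this
  obtain ⟨-, -, h4, -⟩ := this.resolve_left h3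
  exact h4

theorem Valid.mem_indices (h : Valid I k m) {v : ℕ} : v ∈ indices I k m ↔ Present k m v := by
  rw [mem_indices_iff, and_iff_right_iff_imp]
  intro hv
  have := h.lt_n hv
  rw [bound]
  omega

/-- The node `t` is never an index. The strict inequality is what ends the search after `bound I`
passes. -/
theorem Valid.card_indices_lt (h : Valid I k m) : (indices I k m).card < bound I := by
  have h1 : indices I k m ⊂ Finset.range (bound I) := by
    refine (Finset.ssubset_iff_of_subset fun v hv =>
      Finset.mem_range.2 (mem_indices_iff.1 hv).1).2 ⟨I.t, ?_, ?_⟩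
    · have := I.t.2
      rw [Finset.mem_range, bound]
      omega
    · rw [h.mem_indices]
      exact fun h' => (h _ h').2.2.1 rfl
  simpa using Finset.card_lt_card h1

/-- After an exchange the table consists of the new paths and the old ones that were not hit, so it
stays disjoint, and it grows because fewer entries were hit than paths inserted. -/
theorem exists_run_improveStmt (hk : 1 ≤ k) (hm : Valid I k m) (o : List ℕ) :
    ∃ m', (improveStmt k P).run I.encode (bound I) ρ (m, o) = (m', o) ∧ Valid I k m' ∧
      ((m' = m ∧ ¬ Improving I k P m (cand k ρ)) ∨
        ((indices I k m).card < (indices I k m').card ∧ Improving I k P m (cand k ρ))) := by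
  classical
  rw [improveStmt, run_ite]
  simp only [holds_improvingExpr hk]
  split_ifs with himp
  swap
  · exact ⟨m, rfl, hm, .inl ⟨rfl, himp⟩⟩
  set W := cand k ρ with hW
  obtain ⟨hpad, hdisj, hcard⟩ := id himp
  have hmeet : ∀ i < P, ∀ j < P, i ≠ j → ¬ I.Meets k (W i) (W j) := by
    intro i hi j hj hne
    rcases lt_or_gt_of_ne hne with h | h
    · exact hdisj j hj i h
    · exact fun h' => hdisj i hi j h h'.symm
  have hfirst : ∀ i < P, ∀ j < P, i ≠ j → W i 1 ≠ I.t → W i 1 ≠ W j 1 :=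
    fun i hi j hj hne hr h => hmeet i hi j hj hne ⟨1, 1, ⟨le_rfl, hk⟩, ⟨le_rfl, hk⟩, h, hr⟩
  obtain ⟨m₁, e1, hm₁⟩ := run_clearStmt (I := I) (k := k) (P := P) (m := m) (ρ := ρ) o
  obtain ⟨m₂, e2, hm₂, hm₂'⟩ := run_insertAllStmt (I := I) (N := bound I) (k := k) (P := P)
    (m := m₁) (ρ := ρ) o fun j hj i hi => hfirst i (by omega) j hj (by omega)
  rw [← hW] at hm₁ hm₂ hm₂'
  have hnew : ∀ i < P, W i 1 ≠ I.t → Present k m₂ (W i 1) ∧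
      ∀ j ≤ k, W i j = entry k m₂ (W i 1) j := by
    intro i hi hr
    have h0 := hm₂ i hi hr 0 (by omega)
    rw [if_pos rfl, add_zero] at h0
    refine ⟨by rw [Present, h0]; omega, fun j hj => ?_⟩
    by_cases hj0 : j = 0
    · subst hj0
      rw [entry, if_pos rfl, h0, Nat.add_sub_cancel]
    · rw [entry, if_neg hj0, hm₂ i hi hr j hj, if_neg hj0, add_zero]
  have hold : ∀ v, (∀ i < P, W i 1 ≠ I.t → W i 1 ≠ v) → Present k m₂ v →
      Present k m v ∧ ¬ Hit I k P m W v ∧ ∀ j ≤ k, entry k m v j = entry k m₂ v j := by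
    intro v hv hp
    have h0 := hm₂' v hv 0 (by omega)
    rw [add_zero] at h0
    have hnh : ¬ Hit I k P m W v := by
      intro hh
      have hlt := hm.lt_n hh.1
      exact hp (h0.trans ((hm₁ v).1 (by rw [bound]; omega) hh))
    have h1 := (hm₁ v).2.1 hnh
    refine ⟨by rwa [Present, ← h1, ← h0], hnh, fun j hj => ?_⟩
    by_cases hj0 : j = 0
    · subst hj0
      rw [entry, entry, if_pos rfl, if_pos rfl, h0, h1]
    · rw [entry, entry, if_neg hj0, if_neg hj0, hm₂' v hv j hj, (hm₁ v).2.2 j (by omega) hj]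
  have hkeep : ∀ v, Present k m v → ¬ Hit I k P m W v →
      (∀ i < P, W i 1 ≠ I.t → W i 1 ≠ v) ∧ Present k m₂ v := by
    intro v hp hnh
    -- A candidate starting at `v` would meet entry `v` in the node `v`; so insertion never
    -- overwrites a surviving entry.
    have hv : ∀ i < P, W i 1 ≠ I.t → W i 1 ≠ v := by
      intro i hi hr h
      refine hnh ⟨hp, i, hi, 1, 1, ⟨le_rfl, hk⟩, ⟨le_rfl, hk⟩, ?_, ?_⟩
      · rw [(hm v hp).2.1, h]
      · rw [(hm v hp).2.1, ← h]; exact hr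
    refine ⟨hv, ?_⟩
    have h0 := hm₂' v hv 0 (by omega)
    rw [add_zero] at h0
    rw [Present, h0, (hm₁ v).2.1 hnh]
    exact hp
  have hcases : ∀ v, Present k m₂ v → (∃ i < P, W i 1 ≠ I.t ∧ W i 1 = v) ∨
      (∀ i < P, W i 1 ≠ I.t → W i 1 ≠ v) := by
    intro v _
    by_contra! h
    obtain ⟨i, hi, h1, h2⟩ := h.2
    exact h.1 i hi h1 h2
  have hvalid : Valid I k m₂ := by
    intro v hv
    rcases hcases v hv with ⟨i, hi, hr, rfl⟩ | h
    · obtain ⟨-, he⟩ := hnew i hi hr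
      refine ⟨isPadded_congr hk he (hpad i hi), (he 1 hk).symm, hr, fun v' hne hv' => ?_⟩
      rcases hcases v' hv' with ⟨i', hi', hr', rfl⟩ | h'
      · obtain ⟨-, he'⟩ := hnew i' hi' hr'
        rw [← meets_congr (fun j _ hj => he j hj) (fun j _ hj => he' j hj)]
        exact hmeet i hi i' hi' fun h => hne (by rw [h])
      · obtain ⟨hp, hnh, he'⟩ := hold v' h' hv'
        rw [← meets_congr (fun j _ hj => he j hj) (fun j _ hj => he' j hj)]
        exact fun h => hnh ⟨hp, i, hi, h.symm⟩
    · obtain ⟨hp, hnh, he⟩ := hold v h hv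
      refine ⟨isPadded_congr hk he (hm v hp).1, (he 1 hk).symm.trans (hm v hp).2.1,
        (hm v hp).2.2.1, fun v' hne hv' => ?_⟩
      rcases hcases v' hv' with ⟨i', hi', hr', rfl⟩ | h'
      · obtain ⟨-, he'⟩ := hnew i' hi' hr'
        rw [← meets_congr (fun j _ hj => he j hj) (fun j _ hj => he' j hj)]
        exact fun h => hnh ⟨hp, i', hi', h⟩
      · obtain ⟨hp', hnh', he'⟩ := hold v' h' hv'
        rw [← meets_congr (fun j _ hj => he j hj) (fun j _ hj => he' j hj)]
        exact (hm v hp).2.2.2 v' hne hp'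
  refine ⟨m₂, by rw [Stmt.run, e1, e2], hvalid, .inr ⟨?_, himp⟩⟩
  set R := (Finset.range P).filter fun i => W i 1 ≠ I.t with hR
  have hsub : ((indices I k m).filter fun v => ¬ Hit I k P m W v) ∪ R.image (fun i => W i 1) ⊆
      indices I k m₂ := by
    intro v hv
    rw [hvalid.mem_indices]
    rcases Finset.mem_union.1 hv with hv | hv
    · rw [Finset.mem_filter, hm.mem_indices] at hv
      exact (hkeep v hv.1 hv.2).2
    · obtain ⟨i, hi, rfl⟩ := Finset.mem_image.1 hv
      rw [hR, Finset.mem_filter, Finset.mem_range] at hi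
      exact (hnew i hi.1 hi.2).1
  have hdis : Disjoint ((indices I k m).filter fun v => ¬ Hit I k P m W v)
      (R.image fun i => W i 1) := by
    rw [Finset.disjoint_left]
    intro v hv hv'
    rw [Finset.mem_filter, hm.mem_indices] at hv
    obtain ⟨i, hi, h⟩ := Finset.mem_image.1 hv'
    rw [hR, Finset.mem_filter, Finset.mem_range] at hi
    exact (hkeep v hv.1 hv.2).1 i hi.1 hi.2 h
  have hRc : (R.image fun i => W i 1).card = R.card := by
    refine Finset.card_image_of_injOn fun i hi j hj hij => ?_
    rw [hR, Finset.mem_coe, Finset.mem_filter, Finset.mem_range] at hi hj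
    by_contra hne
    exact hfirst i hi.1 j hj.1 hne hi.2 hij
  have hle := Finset.card_le_card hsub
  rw [Finset.card_union_of_disjoint hdis, hRc] at hle
  have hsplit := Finset.card_filter_add_card_filter_not (s := indices I k m) (Hit I k P m W)
  have hhit : ((indices I k m).filter (Hit I k P m W)).card ≤
      ((Finset.range (bound I)).filter (Hit I k P m W)).card :=
    Finset.card_le_card (Finset.filter_subset_filter _ (Finset.filter_subset _ _))
  have hcard' : ((Finset.range (bound I)).filter (Hit I k P m W)).card < R.card := by
    convert hcard
  omega

/-- The assignments of values below the loop bound to the variables `2, …, q + 1`. -/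
def Assignments (I : CDPInstance) (q : ℕ) (ρ : ℕ → ℕ) : Set (ℕ → ℕ) :=
  {ρ' | (∀ r, r < 2 ∨ 2 + q ≤ r → ρ' r = ρ r) ∧ ∀ r, 2 ≤ r → r < 2 + q → ρ' r < bound I}

/-- The table may change several times during one pass, but both alternatives refer to the table `m`
at its start: an unchanged table has been tested against all candidates, and the first exchange is
an improvement of `m` itself. -/
theorem exists_run_loops (hk : 1 ≤ k) (q : ℕ) (ρ m : ℕ → ℕ) (hm : Valid I k m) (o : List ℕ) :
    ∃ m', (loops q (improveStmt k P)).run I.encode (bound I) ρ (m, o) = (m', o) ∧ Valid I k m' ∧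
      ((m' = m ∧ ∀ ρ' ∈ Assignments I q ρ, ¬ Improving I k P m (cand k ρ')) ∨
        ((indices I k m).card < (indices I k m').card ∧
          ∃ ρ' ∈ Assignments I q ρ, Improving I k P m (cand k ρ'))) := by
  induction q generalizing ρ m with
  | zero =>
    have key : ∀ ρ', ρ' ∈ Assignments I 0 ρ ↔ ρ' = ρ := by
      intro ρ'
      constructor
      · exact fun h => funext fun r => h.1 r (by omega)
      · rintro rfl
        exact ⟨fun _ _ => rfl, by omega⟩
    simp only [key, forall_eq, exists_eq_left]
    exact exists_run_improveStmt hk hm o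
  | succ q ih =>
    have hsub : ∀ b < bound I, ∀ ρ' ∈ Assignments I q (Function.update ρ (2 + q) b),
        ρ' ∈ Assignments I (q + 1) ρ ∧ ρ' (2 + q) = b := by
      intro b hb ρ' hρ'
      have hq : ρ' (2 + q) = b := by rw [hρ'.1 _ (by omega), Function.update_self]
      refine ⟨⟨fun r hr => ?_, fun r h1 h2 => ?_⟩, hq⟩
      · rw [hρ'.1 r (by omega), Function.update_of_ne (by omega)]
      · rcases eq_or_ne r (2 + q) with rfl | hne
        · omega
        · exact hρ'.2 r h1 (by omega)
    suffices ∀ b ≤ bound I, ∃ m', iterate (fun i z => (loops q (improveStmt k P)).run I.encode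
        (bound I) (Function.update ρ (2 + q) i) z) b (m, o) = (m', o) ∧ Valid I k m' ∧
        ((m' = m ∧ ∀ ρ' ∈ Assignments I (q + 1) ρ, ρ' (2 + q) < b →
          ¬ Improving I k P m (cand k ρ')) ∨
        ((indices I k m).card < (indices I k m').card ∧
          ∃ ρ' ∈ Assignments I (q + 1) ρ, Improving I k P m (cand k ρ'))) by
      obtain ⟨m', h1, h2, h3⟩ := this (bound I) le_rfl
      refine ⟨m', h1, h2, h3.imp_left fun h => ⟨h.1, fun ρ' hρ' => h.2 ρ' hρ' ?_⟩⟩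
      exact hρ'.2 _ (by omega) (by omega)
    intro b
    induction b with
    | zero => exact fun _ => ⟨m, rfl, hm, .inl ⟨rfl, fun _ _ h => absurd h (by omega)⟩⟩
    | succ b ihb =>
      intro hb
      obtain ⟨m₁, h1, h2, h3⟩ := ihb (by omega)
      obtain ⟨m₂, k1, k2, k3⟩ := ih (Function.update ρ (2 + q) b) m₁ h2
      rw [iterate, h1]
      refine ⟨m₂, k1, k2, ?_⟩
      rcases h3 with ⟨rfl, h3⟩ | ⟨h3, h4⟩
      · rcases k3 with ⟨rfl, k3⟩ | ⟨k3, ρ', k4, k5⟩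
        · refine .inl ⟨rfl, fun ρ' hρ' hlt => ?_⟩
          obtain hlt | heq : ρ' (2 + q) < b ∨ ρ' (2 + q) = b := by omega
          · exact h3 ρ' hρ' hlt
          · refine k3 ρ' ⟨fun r hr => ?_, fun r h1 h2 => hρ'.2 r h1 (by omega)⟩
            rcases eq_or_ne r (2 + q) with rfl | hne
            · rw [Function.update_self, heq]
            · rw [Function.update_of_ne hne, hρ'.1 r (by omega)]
        · exact .inr ⟨k3, ρ', (hsub b (by omega) ρ' k4).1, k5⟩
      -- An exchange has already happened; the later rounds cannot shrink the table.
      · refine .inr ⟨h3.trans_le ?_, h4⟩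
        rcases k3 with ⟨rfl, -⟩ | ⟨k3, -⟩
        · exact le_rfl
        · exact k3.le

/-- No set of at most `P` candidates improves the table. -/
def LocallyOptimal (I : CDPInstance) (k P : ℕ) (m : ℕ → ℕ) : Prop :=
  ∀ W : ℕ → ℕ → ℕ, (∀ i < P, ∀ j ≤ k, W i j < bound I) → ¬ Improving I k P m W

theorem improving_congr (hk : 1 ≤ k) {W W' : ℕ → ℕ → ℕ} (h : ∀ i < P, ∀ j ≤ k, W i j = W' i j)
    (hW : Improving I k P m W) : Improving I k P m W' := by
  classical
  obtain ⟨h1, h2, h3⟩ := hW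
  refine ⟨fun i hi => isPadded_congr hk (h i hi) (h1 i hi), fun j hj i hi => ?_, ?_⟩
  · rw [← meets_congr (fun a _ ha => h i (by omega) a ha) (fun a _ ha => h j hj a ha)]
    exact h2 j hj i hi
  · convert h3 using 2
    · refine Finset.filter_congr fun v _ => and_congr Iff.rfl (exists_congr fun i =>
        and_congr_right fun hi => ?_)
      exact meets_congr (fun _ _ _ => rfl) fun a _ ha => (h i hi a ha).symm
    · refine Finset.filter_congr fun i hi => ?_
      rw [h i (Finset.mem_range.1 hi) 1 hk]

/-- After `b` passes the table is locally optimal or has at least `b` entries; for `b = bound I` the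
latter is impossible. -/
theorem exists_run_searchStmt (hk : 1 ≤ k) (ρ m : ℕ → ℕ) (hm : Valid I k m) (o : List ℕ) :
    ∃ m', (searchStmt k P).run I.encode (bound I) ρ (m, o) = (m', o) ∧ Valid I k m' ∧
      LocallyOptimal I k P m' := by
  suffices ∀ b, ∃ m', iterate (fun i z => (loops ((k + 1) * P) (improveStmt k P)).run I.encode
      (bound I) (Function.update ρ 1 i) z) b (m, o) = (m', o) ∧ Valid I k m' ∧
      (LocallyOptimal I k P m' ∨ b ≤ (indices I k m').card) by
    obtain ⟨m', h1, h2, h3⟩ := this (bound I)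
    exact ⟨m', h1, h2, h3.resolve_right (by have := h2.card_indices_lt; omega)⟩
  intro b
  induction b with
  | zero => exact ⟨m, rfl, hm, .inr (by omega)⟩
  | succ b ih =>
    obtain ⟨m₁, h1, h2, h3⟩ := ih
    obtain ⟨m₂, k1, k2, k3⟩ := exists_run_loops (P := P) hk ((k + 1) * P)
      (Function.update ρ 1 b) m₁ h2 o
    rw [iterate, h1]
    refine ⟨m₂, k1, k2, ?_⟩
    have haddr : ∀ i < P, ∀ j ≤ k, (k + 1) * i + j < (k + 1) * P := by
      intro i hi j hj
      calc _ < (k + 1) * (i + 1) := by rw [mul_add]; omega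
        _ ≤ _ := Nat.mul_le_mul_left _ hi
    rcases k3 with ⟨rfl, k3⟩ | ⟨k3, ρ', k4, k5⟩
    · refine .inl fun W hW himp => ?_
      -- Division with remainder by `k + 1` inverts the numbering of slots in `cand`, so any bounded
      -- family `W` is one of the enumerated assignments.
      set ρ' : ℕ → ℕ := fun r => if r < 2 ∨ 2 + (k + 1) * P ≤ r then Function.update ρ 1 b r
        else W ((r - 2) / (k + 1)) ((r - 2) % (k + 1)) with hρ'
      refine k3 ρ' ⟨fun r hr => if_pos hr, fun r hr1 hr2 => ?_⟩
        (improving_congr hk (fun i hi j hj => ?_) himp)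
      · rw [hρ']
        simp only
        rw [if_neg (by omega)]
        refine hW _ (Nat.div_lt_of_lt_mul (by omega)) _ ?_
        exact Nat.lt_succ_iff.1 (Nat.mod_lt (r - 2) (Nat.succ_pos k))
      · have := haddr i hi j hj
        rw [cand, hρ']
        simp only
        rw [if_neg (by omega), Nat.add_sub_cancel_left, Nat.mul_add_div (Nat.succ_pos k),
          Nat.mul_add_mod, Nat.div_eq_of_lt (by omega), Nat.mod_eq_of_lt (by omega), add_zero]
    · rcases h3 with h3 | h3
      -- A locally optimal table admits no exchange, so this pass cannot have changed it.
      · refine absurd k5 (h3 _ fun i hi j hj => k4.2 _ (by omega) ?_)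
        have := haddr i hi j hj
        omega
      · exact .inr (by omega)

end LCDP

namespace LCDP

open RAM RAM.Expr

variable {I : CDPInstance} {k P : ℕ} {m ρ : ℕ → ℕ}

/-! ### Output -/

theorem run_loop_append {x : List ℕ} {N r : ℕ} {B : Stmt} (F : ℕ → List ℕ)
    (hB : ∀ v o, B.run x N (Function.update ρ r v) (m, o) = (m, o ++ F v)) (o : List ℕ) :
    (Stmt.loop r B).run x N ρ (m, o) = (m, o ++ (List.range N).flatMap F) := by
  rw [Stmt.run]
  suffices ∀ b, iterate (fun i z => B.run x N (Function.update ρ r i) z) b (m, o) =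
      (m, o ++ (List.range b).flatMap F) from this N
  intro b
  induction b with
  | zero => simp [iterate]
  | succ b ih => rw [iterate, ih, hB, List.range_succ, List.flatMap_append]; simp

open scoped Classical in
/-- The output for the path of length one of color `i`. -/
noncomputable def directOutput (I : CDPInstance) (i : ℕ) : List ℕ :=
  if I.AdjNat i I.s I.t then [i, 2, (I.s : ℕ), (I.t : ℕ)] else []

theorem run_outputDirectStmt (o : List ℕ) :
    outputDirectStmt.run I.encode (bound I) ρ (m, o) =
      (m, o ++ (List.range (bound I)).flatMap (directOutput I)) := by
  classical
  refine run_loop_append _ (fun i o => ?_) o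
  rw [run_ite, directOutput]
  simp only [holds_adjExpr (ignoresZero_var one_ne_zero) ignoresZero_sExpr, eval_sExpr,
    eval_tExpr, Expr.eval, Function.update_self]
  split_ifs <;> simp [Stmt.run, Expr.eval]

open scoped Classical in
/-- The output for the table entry `v`. -/
noncomputable def tableOutput (I : CDPInstance) (k : ℕ) (m : ℕ → ℕ) (v : ℕ) : List ℕ :=
  if Present k m v then
    entry k m v 0 :: (2 + (I.interior k (entry k m v)).length) ::
      ((I.s : ℕ) :: I.interior k (entry k m v) ++ [(I.t : ℕ)])
  else []

theorem run_outputTableStmt (o : List ℕ) :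
    (outputTableStmt k).run I.encode (bound I) ρ (m, o) =
      (m, o ++ (List.range (bound I)).flatMap (tableOutput I k m)) := by
  classical
  refine run_loop_append _ (fun v o => ?_) o
  have hpos : ∀ j, (tableExpr k (j + 1)).eval I.encode (bound I) m (Function.update ρ 1 v) =
      entry k m v (j + 1) := fun j => by
    rw [eval_tableExpr_of_pos (by omega), Function.update_self]
  have hzero : (tableExpr k 0).eval I.encode (bound I) m (Function.update ρ 1 v) =
      m ((k + 1) * v) := by
    rw [eval_tableExpr, Function.update_self, add_zero]
  have hne : ∀ j, (Expr.not (Expr.eq (tableExpr k (j + 1)) tExpr)).Holds I.encode (bound I) m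
      (Function.update ρ 1 v) ↔ entry k m v (j + 1) ≠ I.t := fun j => by
    rw [holds_not, holds_eq, hpos, eval_tExpr]
  have hlen : (sumBelow k fun j => indicator (Expr.not (Expr.eq (tableExpr k (j + 1)) tExpr))).eval
      I.encode (bound I) m (Function.update ρ 1 v) = (I.interior k (entry k m v)).length := by
    rw [eval_sumBelow_indicator (p := fun j => entry k m v (j + 1) ≠ I.t) fun j _ => hne j,
      CDPInstance.interior, List.filter_map, List.length_map]
    rfl
  have hwrite : ∀ b o, iterate (fun j z => (Stmt.ite
      (Expr.not (Expr.eq (tableExpr k (j + 1)) tExpr)) (.write (tableExpr k (j + 1))) .skip).run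
      I.encode (bound I) (Function.update ρ 1 v) z) b (m, o) =
      (m, o ++ I.interior b (entry k m v)) := by
    intro b o
    induction b with
    | zero => simp [iterate, CDPInstance.interior]
    | succ b ih =>
      rw [iterate, ih, run_ite]
      simp only [hne]
      rw [CDPInstance.interior, CDPInstance.interior, List.range_succ, List.map_append,
        List.filter_append]
      split_ifs with h <;> simp [Stmt.run, hpos, h]
  have hseq : ∀ o, (seqBelow k fun j => .ite
      (Expr.not (Expr.eq (tableExpr k (j + 1)) tExpr)) (.write (tableExpr k (j + 1))) .skip).run
      I.encode (bound I) (Function.update ρ 1 v) (m, o) =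
      (m, o ++ I.interior k (entry k m v)) := fun o => by rw [run_seqBelow, hwrite]
  have hpresent : (tableExpr k 0).Holds I.encode (bound I) m (Function.update ρ 1 v) ↔
      Present k m v := by rw [Holds, hzero, Present]
  rw [run_ite, tableOutput]
  simp only [hpresent]
  split_ifs with h
  · simp only [Stmt.run, hseq, Expr.eval, hzero, hlen, eval_sExpr, eval_tExpr, entry, if_pos]
    simp
  · simp [Stmt.run]

theorem exists_run_mainStmt (hk : 1 ≤ k) :
    ∃ m, Valid I k m ∧ LocallyOptimal I k P m ∧
      ((mainStmt k P).run I.encode (bound I) (fun _ => 0) (fun _ => 0, [])).2 =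
        (List.range (bound I)).flatMap (directOutput I) ++
          (List.range (bound I)).flatMap (tableOutput I k m) := by
  obtain ⟨m, h1, h2, h3⟩ := exists_run_searchStmt (I := I) (P := P) hk (fun _ => 0) (fun _ => 0)
    (fun v hv => absurd rfl hv) []
  refine ⟨m, h2, h3, ?_⟩
  rw [mainStmt, Stmt.run, Stmt.run, h1, run_outputDirectStmt, run_outputTableStmt, List.nil_append]

end LCDP

/-! ### From the final table to a solution and its ratio -/

namespace CDPInstance

open LCDP

variable {I : CDPInstance} {k P : ℕ} {m : ℕ → ℕ}

/-- The output for one path. -/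
def UnicolorPath.encode (P : I.UnicolorPath) : List ℕ :=
  (P.color : ℕ) :: P.walk.support.length :: P.walk.support.map Fin.val

theorem encodeSolution_eq (S : List I.UnicolorPath) :
    encodeSolution S = S.flatMap UnicolorPath.encode := by
  unfold encodeSolution UnicolorPath.encode
  congr 1
  funext P
  simp [List.map_eq_flatMap]

theorem exists_direct_path (i : ℕ) (hi : I.AdjNat i I.s I.t) :
    ∃ P : I.UnicolorPath, (P.color : ℕ) = i ∧ P.walk.support = [I.s, I.t] := by
  obtain ⟨h1, h2, h3, hadj⟩ := hi
  exact ⟨⟨⟨i, h1⟩, hadj.toWalk, SimpleGraph.Walk.IsPath.of_adj hadj⟩, rfl, rfl⟩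

theorem UnicolorPath.ext_of_length_eq_one {P Q : I.UnicolorPath} (hP : P.walk.length = 1)
    (hQ : Q.walk.length = 1) (h : P.color = Q.color) : P = Q := by
  have key : ∀ {G : SimpleGraph (Fin I.n)} {u v : Fin I.n} (p q : G.Walk u v),
      p.length = 1 → q.length = 1 → p = q := by
    intro G u v p q hp hq
    cases p with
    | nil => simp at hp
    | cons h p =>
      cases q with
      | nil => simp at hq
      | cons h' q =>
        rw [SimpleGraph.Walk.length_cons, Nat.add_eq_right] at hp hq
        cases p with
        | cons => simp at hp
        | nil =>
          cases q with
          | cons => simp at hq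
          | nil => rfl
  obtain ⟨i, p, hp⟩ := P
  obtain ⟨j, q, hq⟩ := Q
  obtain rfl : i = j := h
  obtain rfl := key p q hP hQ
  rfl

theorem UnicolorPath.pad_lt (P : I.UnicolorPath) (j : ℕ) : P.pad j < bound I := by
  rw [pad, bound]
  split_ifs
  · have := P.color.2
    omega
  · have := (P.walk.getVert j).2
    omega

open scoped Classical in
/-- The number of paths of length one. -/
noncomputable def numDirect (I : CDPInstance) : ℕ :=
  ((Finset.range (bound I)).filter fun i => I.AdjNat i I.s I.t).card

/-- A subset of `B` with at most `(k + 1) ^ r` paths is a candidate family, so it cannot improve the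
table; this is the local Hall condition. Paths of length one are excluded, as their padding reads as
no path. -/
theorem card_le_of_locallyOptimal (hk : 2 ≤ k) (r : ℕ) (hm : Valid I k m)
    (hopt : LocallyOptimal I k ((k + 1) ^ r) m) (B : Finset I.UnicolorPath)
    (hB : ∀ Q ∈ B, Q.walk.length ≤ k + 1) (hB1 : ∀ Q ∈ B, Q.walk.length ≠ 1)
    (hdisj : ∀ Q ∈ B, ∀ R ∈ B, Q ≠ R → Q.InternallyDisjoint R) :
    r * (2 * B.card) ≤ r * (k * (indices I k m).card) + (indices I k m).card := by
  classical
  refine two_mul_card_le_of_locally_optimal hk r (indices I k m) B (entry k m) UnicolorPath.pad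
    (fun a ha b hb hne => (hm a (hm.mem_indices.1 ha)).2.2.2 b hne.symm (hm.mem_indices.1 hb))
    (fun Q hQ R hR hne => (hdisj Q hQ R hR hne).not_meets) ?_
  intro S hS hSc
  -- Unused places get the constant sequence `t`, which stands for no path: it is padded, meets
  -- nothing and is not counted as real.
  let W : ℕ → ℕ → ℕ := fun i =>
    if h : i < S.card then (S.equivFin.symm ⟨i, h⟩ : I.UnicolorPath).pad else fun _ => I.t
  have hW : ∀ i (h : i < S.card), W i = (S.equivFin.symm ⟨i, h⟩ : I.UnicolorPath).pad :=
    fun i h => dif_pos h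
  have hW' : ∀ i, ¬ i < S.card → W i = fun _ => (I.t : ℕ) := fun i h => dif_neg h
  have hSB : ∀ j, (S.equivFin.symm j : I.UnicolorPath) ∈ B :=
    fun j => hS (S.equivFin.symm j).2
  have hnot : ¬ ((Finset.range (bound I)).filter (Hit I k ((k + 1) ^ r) m W)).card <
      ((Finset.range ((k + 1) ^ r)).filter fun i => W i 1 ≠ I.t).card := by
    intro hlt
    refine hopt W (fun i _ j _ => ?_) ⟨fun i _ => ?_, fun j _ i hij => ?_, by convert hlt⟩
    · by_cases h : i < S.card
      · rw [hW i h]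
        exact UnicolorPath.pad_lt _ _
      · rw [hW' i h]
        exact I.t.2.trans_le (Nat.le_add_right _ _)
    · by_cases h : i < S.card
      · rw [hW i h]
        exact UnicolorPath.isPadded_pad (by omega) _ (hB _ (hSB _))
      · rw [hW' i h]
        exact ⟨fun _ _ _ h => I.s_ne_t (Fin.ext h.symm), fun _ _ _ _ _ _ => rfl, .inl rfl,
          fun _ _ _ => .inl ⟨rfl, rfl⟩, .inl rfl⟩
    · by_cases h : j < S.card
      · rw [hW i (hij.trans h), hW j h]
        refine (hdisj _ (hSB _) _ (hSB _) fun heq => ?_).not_meets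
        have := S.equivFin.symm.injective (Subtype.ext heq)
        simp only [Fin.mk.injEq] at this
        omega
      · rw [hW' j h]
        rintro ⟨a, b, -, -, h1, h2⟩
        exact h2 h1
  have h1 : S.card ≤ ((Finset.range ((k + 1) ^ r)).filter fun i => W i 1 ≠ I.t).card := by
    calc S.card = (Finset.range S.card).card := (Finset.card_range _).symm
      _ ≤ _ := Finset.card_le_card fun i hi => by
        rw [Finset.mem_range] at hi
        rw [Finset.mem_filter, Finset.mem_range, hW i hi, Ne, UnicolorPath.pad_eq_t_iff _ le_rfl]
        refine ⟨hi.trans_le hSc, fun h => ?_⟩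
        have h2 := UnicolorPath.one_le_length (S.equivFin.symm ⟨i, hi⟩ : I.UnicolorPath)
        exact hB1 _ (hSB ⟨i, hi⟩) (le_antisymm h h2)
  refine h1.trans ((not_lt.1 hnot).trans (Finset.card_le_card fun v hv => ?_))
  rw [Finset.mem_filter] at hv ⊢
  obtain ⟨-, hp, i, hi, h⟩ := hv
  refine ⟨hm.mem_indices.2 hp, ?_⟩
  by_cases hi' : i < S.card
  · rw [hW i hi'] at h
    exact ⟨_, (S.equivFin.symm ⟨i, hi'⟩).2, h⟩
  · rw [hW' i hi'] at h
    obtain ⟨a, b, -, -, h1, h2⟩ := h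
    exact absurd h1 h2

/-- The ratio achieved by a locally optimal table. -/
theorem length_le_of_locallyOptimal (hk : 2 ≤ k) {r : ℕ} (hr : 0 < r) {ε : ℝ}
    (hε : 1 ≤ 2 * r * ε) (hm : Valid I k m)
    (hopt : LocallyOptimal I k ((k + 1) ^ r) m) (T : List I.UnicolorPath)
    (hT : I.IsFeasible (k + 1) T) :
    (T.length : ℝ) ≤ ((k : ℝ) / 2 + ε) * (I.numDirect + (indices I k m).card : ℕ) := by
  classical
  obtain ⟨hnd, hlen, hdisj⟩ := hT
  have : Std.Symm (UnicolorPath.InternallyDisjoint (I := I)) :=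
    ⟨fun P Q h v h1 h2 => h v h2 h1⟩
  have hdisj' : ∀ Q ∈ T, ∀ R ∈ T, Q ≠ R → Q.InternallyDisjoint R :=
    fun Q hQ R hR hne => hdisj.forall hQ hR hne
  set D := T.toFinset.filter fun Q => Q.walk.length = 1
  set B := T.toFinset.filter fun Q => ¬ Q.walk.length = 1
  have hsplit : D.card + B.card = T.length := by
    rw [← List.toFinset_card_of_nodup hnd]
    exact Finset.card_filter_add_card_filter_not _
  have hD : D.card ≤ I.numDirect := by
    refine Finset.card_le_card_of_injOn (fun Q => (Q.color : ℕ)) (fun Q hQ => ?_)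
      fun Q hQ R hR h => ?_
    · have hQ := (Finset.mem_filter.1 hQ).2
      rw [Finset.coe_filter]
      refine ⟨?_, ?_⟩
      · exact Finset.mem_range.2 (Q.color.2.trans_le (Nat.le_add_left _ _))
      · have := Q.adjNat_getVert (j := 0) (by omega)
        rwa [Q.walk.getVert_zero, zero_add, ← hQ, Q.walk.getVert_length] at this
    · exact UnicolorPath.ext_of_length_eq_one (Finset.mem_filter.1 hQ).2
        (Finset.mem_filter.1 hR).2 (Fin.ext h)
  have hmem : ∀ Q ∈ B, Q ∈ T ∧ Q.walk.length ≠ 1 := fun Q hQ => by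
    simpa [B] using hQ
  have hBc := card_le_of_locallyOptimal hk r hm hopt B (fun Q hQ => hlen Q (hmem Q hQ).1)
    (fun Q hQ => (hmem Q hQ).2) fun Q hQ R hR => hdisj' Q (hmem Q hQ).1 R (hmem R hR).1
  have hBc' : (r : ℝ) * (2 * B.card) ≤ r * (k * (indices I k m).card) + (indices I k m).card := by
    exact_mod_cast hBc
  have hr' : (0 : ℝ) < r := by exact_mod_cast hr
  have hk' : (2 : ℝ) ≤ k := by exact_mod_cast hk
  have hε' : 0 < ε := by
    by_contra! h
    nlinarith
  have hD' : (D.card : ℝ) ≤ I.numDirect := by exact_mod_cast hD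
  rw [← hsplit]
  push_cast
  have ha : (0 : ℝ) ≤ (indices I k m).card := by positivity
  have hd : (0 : ℝ) ≤ I.numDirect := by positivity
  -- Division of `hBc'` by `2 * r` leaves the error `1 / (2 * r) ≤ ε`.
  have h1 : (B.card : ℝ) ≤ ((k : ℝ) / 2 + ε) * (indices I k m).card := by
    refine le_of_mul_le_mul_left ?_ (mul_pos hr' two_pos)
    have := mul_le_mul_of_nonneg_right hε ha
    nlinarith
  -- All paths of length one are in the output, and the ratio is at least one because `2 ≤ k`.
  have h2 : (I.numDirect : ℝ) ≤ ((k : ℝ) / 2 + ε) * I.numDirect :=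
    le_mul_of_one_le_left hd (by linarith)
  rw [mul_add]
  linarith

theorem _root_.exists_option_choice {α β : Type*} {p : α → Prop} {q : α → β → Prop}
    (h : ∀ a, p a → ∃ b, q a b) :
    ∃ g : α → Option β, (∀ a, (g a).isSome ↔ p a) ∧ ∀ a b, g a = some b → p a ∧ q a b := by
  classical
  refine ⟨fun a => if h' : p a then some (h a h').choose else none, fun a => ?_, fun a b hab => ?_⟩
  · by_cases h' : p a <;> simp [h']
  · by_cases h' : p a
    · simp only [h', dite_true, Option.some.injEq] at hab
      exact ⟨h', hab ▸ (h a h').choose_spec⟩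
    · simp [h'] at hab

theorem _root_.List.flatMap_filterMap_of_eq {β γ : Type*} (g : ℕ → Option β) (f : β → List γ)
    (F : ℕ → List γ) (h : ∀ a b, g a = some b → f b = F a) (h' : ∀ a, g a = none → F a = [])
    (l : List ℕ) : (l.filterMap g).flatMap f = l.flatMap F := by
  induction l with
  | nil => rfl
  | cons a l ih =>
    rw [List.flatMap_cons, ← ih]
    cases hg : g a with
    | none => rw [List.filterMap_cons_none hg, h' a hg, List.nil_append]
    | some b => rw [List.filterMap_cons_some hg, List.flatMap_cons, h a b hg]

/-- Direct paths are disjoint from everything and differ by color. Table paths are distinct because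
entry `v` contains `v` as an internal node and no other entry does; having an internal node also
separates them from direct paths. -/
theorem exists_solution (hk : 1 ≤ k) (hm : Valid I k m) :
    ∃ S : List I.UnicolorPath, I.IsFeasible (k + 1) S ∧
      S.length = I.numDirect + (indices I k m).card ∧
      encodeSolution S = (List.range (bound I)).flatMap (directOutput I) ++
          (List.range (bound I)).flatMap (tableOutput I k m) := by
  classical
  obtain ⟨g, hg, hg'⟩ := exists_option_choice (exists_direct_path (I := I))
  obtain ⟨f, hf, hf'⟩ := exists_option_choice (p := Present k m) (q := fun v (P : I.UnicolorPath) =>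
      (P.color : ℕ) = entry k m v 0 ∧ P.walk.length ≤ k + 1 ∧ P.walk.support.map Fin.val =
        (I.s : ℕ) :: I.interior k (entry k m v) ++ [(I.t : ℕ)]) fun v hv => by
    obtain ⟨h1, h2, h3, -⟩ := hm v hv
    exact h1.exists_unicolorPath hk (by rwa [h2])
  have hcard : ∀ {p : ℕ → Prop} [DecidablePred p] {h : ℕ → Option I.UnicolorPath},
      (∀ a, (h a).isSome ↔ p a) → ((List.range (bound I)).filterMap h).length =
        ((Finset.range (bound I)).filter p).card := by
    intro p _ h hp
    rw [List.length_filterMap_eq_countP, List.countP_eq_length_filter]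
    change _ = ((List.range (bound I)).filter fun a => decide (p a)).length
    congr 2
    funext a
    rw [Bool.eq_iff_iff, hp, decide_eq_true_eq]
  have hsupp : ∀ v P, f v = some P → ∀ u : Fin I.n, u ∈ P.walk.support →
      u = I.s ∨ u = I.t ∨ (u : ℕ) ∈ I.interior k (entry k m v) := by
    intro v P hP u hu
    have := List.mem_map_of_mem (f := Fin.val) hu
    rw [(hf' v P hP).2.2.2, List.cons_append, List.mem_cons, List.mem_append,
      List.mem_singleton, Fin.val_inj, Fin.val_inj] at this
    tauto
  have hint : ∀ v, Present k m v → v ∈ I.interior k (entry k m v) := fun v hv =>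
    mem_interior.2 ⟨1, ⟨le_rfl, hk⟩, (hm v hv).2.1, (hm v hv).2.2.1⟩
  have hfirst : ∀ v P, f v = some P → v ∈ P.walk.support.map Fin.val := by
    intro v P hP
    rw [(hf' v P hP).2.2.2]
    simp [hint v (hf' v P hP).1]
  have hmeets : ∀ v v' u, Present k m v → Present k m v' → v ≠ v' →
      u ∈ I.interior k (entry k m v) → u ∉ I.interior k (entry k m v') := by
    intro v v' u hv hv' hne h1 h2
    obtain ⟨i, hi, rfl, ht⟩ := mem_interior.1 h1
    obtain ⟨j, hj, h, -⟩ := mem_interior.1 h2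
    exact (hm v hv).2.2.2 v' hne.symm hv' ⟨i, j, hi, hj, h.symm, ht⟩
  have hpair : ((List.range (bound I)).filterMap g ++ (List.range (bound I)).filterMap f).Pairwise
      fun P Q => P ≠ Q ∧ P.InternallyDisjoint Q := by
    have hdir : ∀ i P, g i = some P → ∀ Q, P.InternallyDisjoint Q := by
      intro i P hP Q v hv _
      rw [(hg' i P hP).2.2] at hv
      simpa using hv
    rw [List.pairwise_append, List.pairwise_filterMap, List.pairwise_filterMap]
    refine ⟨List.nodup_range.imp ?_, List.nodup_range.imp ?_, ?_⟩
    · refine fun {i j} hne P hP Q hQ => ⟨?_, hdir i P hP Q⟩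
      rintro rfl
      exact hne ((hg' i P hP).2.1.symm.trans (hg' j P hQ).2.1)
    · refine fun {v v'} hne P hP Q hQ => ⟨?_, fun u hu hu' => ?_⟩
      · rintro rfl
        have h1 := (hf' v P hP).1
        have h2 := (hf' v' P hQ).1
        obtain ⟨u, hu, hv⟩ := List.mem_map.1 (hfirst v P hP)
        rcases hsupp v' P hQ u hu with rfl | rfl | h
        · obtain ⟨j, hj, h, -⟩ := mem_interior.1 (hint v h1)
          exact (hm v h1).1.ne_s j hj.1 hj.2 (h.trans hv.symm)
        · exact (hm v h1).2.2.1 hv.symm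
        · rw [hv] at h
          exact hmeets v v' v h1 h2 hne (hint v h1) h
      · by_contra! hst
        have h1 := ((hsupp v P hP u hu).resolve_left hst.1).resolve_left hst.2
        have h2 := ((hsupp v' Q hQ u hu').resolve_left hst.1).resolve_left hst.2
        exact hmeets v v' u (hf' v P hP).1 (hf' v' Q hQ).1 hne h1 h2
    · intro P hP Q hQ
      obtain ⟨i, -, hi⟩ := List.mem_filterMap.1 hP
      refine ⟨?_, hdir i P hi Q⟩
      rintro rfl
      obtain ⟨v, -, hv⟩ := List.mem_filterMap.1 hQ
      obtain ⟨u, hu, huv⟩ := List.mem_map.1 (hfirst v P hv)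
      have h1 := (hf' v P hv).1
      rw [(hg' i P hi).2.2] at hu
      obtain ⟨j, hj, h, ht⟩ := mem_interior.1 (hint v h1)
      rcases (by simpa using hu : u = I.s ∨ u = I.t) with rfl | rfl
      · exact (hm v h1).1.ne_s j hj.1 hj.2 (h.trans huv.symm)
      · exact ht huv.symm
  refine ⟨(List.range (bound I)).filterMap g ++ (List.range (bound I)).filterMap f,
    ⟨hpair.imp fun h => h.1, fun P hP => ?_, hpair.imp fun h => h.2⟩, ?_, ?_⟩
  · rcases List.mem_append.1 hP with hP | hP
    · obtain ⟨i, -, hi⟩ := List.mem_filterMap.1 hP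
      have := congrArg List.length (hg' i P hi).2.2
      rw [SimpleGraph.Walk.length_support] at this
      simp at this
      omega
    · obtain ⟨v, -, hv⟩ := List.mem_filterMap.1 hP
      exact (hf' v P hv).2.2.1
  · rw [List.length_append, hcard hg, hcard hf, numDirect, indices]
  · rw [encodeSolution_eq, List.flatMap_append]
    congr 1
    · refine List.flatMap_filterMap_of_eq g _ _ (fun i P hP => ?_) (fun i hi => ?_) _
      · obtain ⟨h1, h2, h3⟩ := hg' i P hP
        rw [UnicolorPath.encode, directOutput, if_pos h1, h2, h3]
        rfl
      · refine if_neg fun h => ?_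
        rw [← hg, hi] at h
        simp at h
    · refine List.flatMap_filterMap_of_eq f _ _ (fun v P hP => ?_) (fun v hv => ?_) _
      · obtain ⟨h1, h2, -, h3⟩ := hf' v P hP
        rw [UnicolorPath.encode, tableOutput, if_pos h1, h2, h3, ← List.length_map Fin.val, h3]
        simp only [List.length_append, List.length_cons, List.length_nil]
        congr 2
        omega
      · refine if_neg fun h => ?_
        rw [← hf, hv] at h
        simp at h

end CDPInstance

theorem mainTheorem3 (l : ℕ) (hl : 3 < l) (ε : ℝ) (hε : 0 < ε) :
    LCDPPolyTimeApproximable l (((l : ℝ) - 1) / 2 + ε) := by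
  obtain ⟨k, rfl⟩ : ∃ k, l = k + 1 := ⟨l - 1, by omega⟩
  -- The depth `r` of the peeling fixes the exchange size `(k + 1) ^ r`, hence the program, before
  -- the instance is given.
  obtain ⟨r, hr⟩ := exists_nat_gt (1 / (2 * ε))
  have hr0 : 0 < r := by
    have : (0 : ℝ) < r := lt_trans (by positivity) hr
    exact_mod_cast this
  have hrε : 1 ≤ 2 * r * ε := by
    rw [div_lt_iff₀ (by positivity)] at hr
    linarith
  refine ⟨(LCDP.mainStmt k ((k + 1) ^ r)).program, 4 + (LCDP.mainStmt k ((k + 1) ^ r)).time,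
    fun I => ?_⟩
  obtain ⟨t, ht, hout⟩ := (LCDP.mainStmt k ((k + 1) ^ r)).outputs_program I.encode
  obtain ⟨m, hm, hopt, hrun⟩ := LCDP.exists_run_mainStmt (I := I) (k := k) (P := (k + 1) ^ r)
    (by omega)
  obtain ⟨S, hS, hlen, henc⟩ := CDPInstance.exists_solution (by omega) hm
  refine ⟨t, S, ?_, ?_, hS, fun T hT => ?_⟩
  · rw [henc, ← hrun]
    exact hout
  · rw [Polynomial.eval_add, Polynomial.eval_ofNat]
    exact ht.trans (Nat.add_le_add_left
      (Polynomial.eval_mono_nat _ I.n_add_c_le_length_encode) _)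
  · rw [hlen]
    have := CDPInstance.length_le_of_locallyOptimal (by omega) hr0 hrε hm hopt T hT
    push_cast at this ⊢
    rwa [add_sub_cancel_right]
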